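/- **Corollary (Crude bias bound).** Let $\mathcal H\neq\{0\}$ be a real separable Hilbert space (of finite or countably infinite dimension), let $\mathcal D$ be a probability distribution of $(x,y)\in\mathcal H\times\mathbb R$, and let $L(w)=\frac12\,\mathbb E_{(x,y)\sim\mathcal D}[(y-\langle w,x\rangle)^2]$. Assume: 1. (Regularity) $\mathbb E\|x\|^2$, $\mathbb E\|x\|^4$ and $\mathbb E[y^2]$ are finite, $H:=\mathbb E[x x^\top]$ is strictly positive definite (its trace $\operatorname{tr}(H)=\mathbb E\|x\|^2$ is finite), and $w^*$ is the minimizer of $L$. 2. (Fourth moment condition) $\alpha>0$ is a constant such that $\mathbb E[xx^\top A\,xx^\top]\preceq\alpha\operatorname{tr}(HA)\,H$ for every bounded positive semidefinite operator $A$ on $\mathcal H$. 3. (Noise condition) $\Sigma:=\mathbb E[(y-\langle w^*,x\rangle)^2xx^\top]$ exists, and $H^{-1/2}\Sigma H^{-1/2}$ is (extends to) a bounded operator; put $\sigma^2:=\|H^{-1/2}\Sigma H^{-1/2}\|$. Let $H=\sum_i\lambda_iv_iv_i^\top$ be the eigendecomposition of $H$ with $\lambda_1\ge\lambda_2\ge\cdots$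 (and $\lambda_i=0$ for $i>\dim\mathcal H$ if the dimension is finite). Let $(x_1,y_1),(x_2,y_2),\dots$ be i.i.d. samples from $\mathcal D$, let $w_0\in\mathcal H$ and $N\ge1$, and let $$w_t=w_{t-1}+\gamma\,(y_t-\langle w_{t-1},x_t\rangle)\,x_t,\qquad \overline w_N=\frac1N\sum_{t=0}^{N-1}w_t,\qquad \gamma=\frac{1}{2\alpha\sum_i\lambda_i}.$$ Let $k^*=\max\{k\ge1:\lambda_k\ge 2\alpha\sum_i\lambda_i/N\}$, with $k^*=0$ if there is no such $k$. Then $L(\overline w_N)$ is integrable and $$\mathbb E[L(\overline w_N)]-L(w^*)\le\frac{8\alpha\|w_0-w^*\|^2\sum_i\lambda_i}{N}+4\sigma^2\left(\frac{k^*}{N}+\frac{N\sum_{i>k^*}\lambda_i^2}{4\alpha^2(\sum_i\lambda_i)^2}\right).$$ In particular, the bias error never decays more slowly than $O(1/N)$: for the bias iterates $\beta_0=w_0-w^*$, $\beta_t=(I-\gamma x_tx_t^\top)\beta_{t-1}$ and their average $\overline\beta_N=\frac1N\sum_{t=0}^{N-1}\beta_t$, the variable $\langle\overline\beta_N,H\overline\beta_N\rangle$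 is integrable and $$\tfrac12\,\mathbb E\langle\overline\beta_N,H\overline\beta_N\rangle\le\frac{8\alpha\|w_0-w^*\|^2\sum_i\lambda_i}{N}.$$ -/

import Mathlib

open MeasureTheory ProbabilityTheory

open scoped RealInnerProductSpace

noncomputable section

namespace SGDRegression

variable {E : Type*} [NormedAddCommGroup E] [InnerProductSpace ℝ E]

/-- The operator `x xᵀ`, that is `u ↦ ⟪x, u⟫ x`. -/
def outer (x : E) : E →L[ℝ] E := InnerProductSpace.rankOne ℝ x x

/-- The trace `∑ᵢ ⟪eᵢ, T eᵢ⟫` over an orthonormal (Hilbert) basis of `E`. The value does not depend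
on the basis whenever `T` is of trace class, which is the only case in which it is used. -/
def trace [CompleteSpace E] (T : E →L[ℝ] E) : ℝ :=
  ∑' e : (exists_hilbertBasis ℝ E).choose, ⟪(e : E), T (e : E)⟫

/-- `T = ∑ᵢ λᵢ vᵢ vᵢᵀ` (in operator norm) with eigenvalues sorted in non-increasing order and
orthonormal eigenvectors; `lam i`, `v i` stand for `λ_{i+1}`, `v_{i+1}`. If `E` has finite
dimension `d`, the sequence is continued by zeros: `lam i = 0` for `i ≥ d`, with `v i` immaterial. -/
structure IsEigendecomposition (T : E →L[ℝ] E) (lam : ℕ → ℝ) (v : ℕ → E) : Prop where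
  antitone : Antitone lam
  orthonormal : Orthonormal ℝ (fun i : {i : ℕ // lam i ≠ 0} => v i)
  hasSum : HasSum (fun i => lam i • outer (v i)) T

/-- `k* = max {k : λ_k ≥ c}`, with `k ≥ 1` and `λ_k = lam (k - 1)`; it is `0` if no eigenvalue
reaches the threshold `c`. -/
def effectiveDim (lam : ℕ → ℝ) (c : ℝ) : ℕ :=
  sSup {k : ℕ | 1 ≤ k ∧ c ≤ lam (k - 1)}

/-- The SGD iterates `w_t = w_{t-1} + γ (y_t - ⟪w_{t-1}, x_t⟫) x_t` started at `w₀`, where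
`z t = (x_{t+1}, y_{t+1})` is the example used in step `t + 1`. -/
def sgd (γ : ℝ) (w₀ : E) (z : ℕ → E × ℝ) : ℕ → E
  | 0 => w₀
  | t + 1 => sgd γ w₀ z t + (γ * ((z t).2 - ⟪sgd γ w₀ z t, (z t).1⟫)) • (z t).1

/-- The bias iterates `β_t = (I - γ x_t x_tᵀ) β_{t-1}` started at `β₀`. -/
def biasIterate (γ : ℝ) (β₀ : E) (z : ℕ → E × ℝ) : ℕ → E
  | 0 => β₀
  | t + 1 => biasIterate γ β₀ z t - γ • outer (z t).1 (biasIterate γ β₀ z t)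

/-- The average `(1/N) ∑_{t=0}^{N-1} u_t` of the first `N` iterates. -/
def average (N : ℕ) (u : ℕ → E) : E :=
  (N : ℝ)⁻¹ • ∑ t ∈ Finset.range N, u t

variable [MeasurableSpace E]

/-- The risk `L(w) = ½ 𝔼 (y - ⟪w, x⟫)²` for `(x, y) ∼ 𝒟`. -/
def risk (𝒟 : Measure (E × ℝ)) (w : E) : ℝ :=
  (1 / 2) * ∫ z, (z.2 - ⟪w, z.1⟫) ^ 2 ∂𝒟

/-- The second moment operator `H = 𝔼[x xᵀ]`. -/
def secondMoment (𝒟 : Measure (E × ℝ)) : E →L[ℝ] E :=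
  ∫ z, outer z.1 ∂𝒟

/-- The covariance `Σ = 𝔼[(y - ⟪w, x⟫)² x xᵀ]` of the gradient noise at `w`. -/
def gradientNoise (𝒟 : Measure (E × ℝ)) (w : E) : E →L[ℝ] E :=
  ∫ z, ((z.2 - ⟪w, z.1⟫) ^ 2) • outer z.1 ∂𝒟

/-- Regularity conditions. Since `‖x xᵀ‖ = ‖x‖²` and `‖x ⊗ x ⊗ x ⊗ x‖ = ‖x‖⁴`, the moments exist as
expectations exactly when these norms are integrable; moreover `tr H = 𝔼 ‖x‖²`. The last condition
says that `H` is strictly positive definite. -/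
structure RegularityCondition (𝒟 : Measure (E × ℝ)) : Prop where
  second_moment : Integrable (fun z : E × ℝ => ‖z.1‖ ^ 2) 𝒟
  fourth_moment : Integrable (fun z : E × ℝ => ‖z.1‖ ^ 4) 𝒟
  response : Integrable (fun z : E × ℝ => z.2 ^ 2) 𝒟
  posDef : ∀ u : E, u ≠ 0 → 0 < ⟪u, secondMoment 𝒟 u⟫

/-- Fourth moment condition with constant `α`: for every positive semidefinite bounded operator `A`,
`𝔼[x xᵀ A x xᵀ] ≼ α tr(H A) H` in the Loewner order. -/
def FourthMomentCondition [CompleteSpace E] (𝒟 : Measure (E × ℝ)) (α : ℝ) : Prop :=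
  ∀ A : E →L[ℝ] E, A.IsPositive →
    ∫ z, outer z.1 ∘L A ∘L outer z.1 ∂𝒟 ≤
      (α * trace (secondMoment 𝒟 ∘L A)) • secondMoment 𝒟

/-- Noise condition with noise level `σ`: the covariance `Σ` of the gradient noise at `w` exists, and
`H^{-1/2} Σ H^{-1/2}` is a bounded operator with norm `σ²`. Here `R` is the positive square root of
`H`. In infinite dimension `R` has no bounded inverse, and `R⁻¹ Σ R⁻¹` stands for the bounded
operator `S` with `R S R = Σ`, which is unique as `R` is injective with dense range. -/
def NoiseCondition (𝒟 : Measure (E × ℝ)) (w : E) (σ : ℝ) : Prop :=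
  Integrable (fun z : E × ℝ => ((z.2 - ⟪w, z.1⟫) ^ 2) • outer z.1) 𝒟 ∧
    ∃ R S : E →L[ℝ] E, R.IsPositive ∧ R ∘L R = secondMoment 𝒟 ∧
      R ∘L S ∘L R = gradientNoise 𝒟 w ∧ σ ^ 2 = ‖S‖

end SGDRegression

end

/-! The recursion is affine, so `w_t - w*` splits into a noiseless iterate `β_t` started at `w₀ -
w*` and an iterate `η_t` started at `0` and driven by the residuals `y - ⟪w*, x⟫` (`sgd_eq_add`).
Optimality of `w*` makes the residual noise centred and turns the excess risk of `w` into `½⟪w - w*,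
H(w - w*)⟫` (`risk_eq`). Since `⟪a + b, H(a + b)⟫ ≤ 2⟪a, Ha⟫ + 2⟪b, Hb⟫`, bias and variance can be
bounded separately.

Bias (`bias_le`): the fourth moment condition with `A = I` and `γ α tr H = 1/2` make `𝔼‖β_t‖²` lose
at least `(3/2) γ 𝔼⟪β_t, Hβ_t⟫` per step. Telescoping bounds the sum of these energies by
`2‖β₀‖²/(3γ)`, and convexity passes to the average.

Variance (`variance_le`): fix an eigenvector `v_i` and put `q = 1 - γλ_i`. A step multiplies the
conditional mean by `q`, and the fourth moment condition with `A = YYᵀ` bounds the variance it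
injects. The bound `𝔼⟪v_i, η_t⟫² ≤ 2γσ²(1 - q^t)` then follows by induction over all directions at
once: summed over `i`, it keeps the multiplicative noise below the additive noise. Correlations
between iterates decay geometrically with ratio `q`, so direction `i` contributes at most `(4σ²/N)(1
- q^N)²` to the energy of the average. As `1 - q^N ≤ min(1, Nγλ_i)`, a head direction costs `4σ²/N`
and a tail direction `4σ²Nγ²λ_i²`; the two costs cross at `λ_i = 1/(γN)`, the threshold in the
definition of `k*`. -/

namespace SGDRegression

/-! ### Rank-one operators, eigendecompositions and the trace -/

section Operators

variable {E : Type*} [NormedAddCommGroup E] [InnerProductSpace ℝ E]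

lemma outer_apply (x u : E) : outer x u = ⟪x, u⟫ • x := by
  simp [outer, InnerProductSpace.rankOne_apply]

lemma norm_outer (x : E) : ‖outer x‖ = ‖x‖ ^ 2 := by
  simp [outer, InnerProductSpace.norm_rankOne, sq]

lemma continuous_outer : Continuous (outer : E → E →L[ℝ] E) :=
  (InnerProductSpace.rankOne ℝ (E := E) (F := E)).continuous.clm_apply continuous_id

lemma outer_isPositive (x : E) : (outer x).IsPositive :=
  InnerProductSpace.isPositive_rankOne_self x

lemma trace_comp_outer [CompleteSpace E] (T : E →L[ℝ] E) (x : E) :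
    trace (T ∘L outer x) = ⟪x, T x⟫ := by
  obtain ⟨b, hb⟩ := (exists_hilbertBasis ℝ E).choose_spec
  have h := (b.hasSum_inner_mul_inner x (T x)).tsum_eq
  rw [← h]
  unfold trace
  refine tsum_congr fun e => ?_
  rw [hb]
  simp [outer_apply, inner_smul_right]

section Eigen

variable {T : E →L[ℝ] E} {lam : ℕ → ℝ} {v : ℕ → E}

namespace IsEigendecomposition

lemma norm_eq_one (h : IsEigendecomposition T lam v) {i : ℕ} (hi : lam i ≠ 0) : ‖v i‖ = 1 :=
  h.orthonormal.1 ⟨i, hi⟩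

/-- The terms of a norm-convergent series tend to zero, and the `i`-th term has norm `|lam i|`. With
monotonicity this makes all eigenvalues nonnegative. -/
lemma tendsto_zero (h : IsEigendecomposition T lam v) :
    Filter.Tendsto lam Filter.atTop (nhds 0) := by
  rw [tendsto_zero_iff_norm_tendsto_zero]
  refine (tendsto_zero_iff_norm_tendsto_zero.1 h.hasSum.summable.tendsto_atTop_zero).congr
    fun i => ?_
  by_cases hi : lam i = 0
  · simp [hi]
  · rw [norm_smul, norm_outer, h.norm_eq_one hi]
    simp

lemma nonneg (h : IsEigendecomposition T lam v) (i : ℕ) : 0 ≤ lam i :=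
  h.antitone.le_of_tendsto h.tendsto_zero i

lemma hasSum_apply (h : IsEigendecomposition T lam v) (u : E) :
    HasSum (fun i => (lam i * ⟪v i, u⟫) • v i) (T u) := by
  have := h.hasSum.mapL (ContinuousLinearMap.apply ℝ E u)
  simpa [outer_apply, smul_smul] using this

lemma apply_eq (h : IsEigendecomposition T lam v) {j : ℕ} (hj : lam j ≠ 0) :
    T (v j) = lam j • v j := by
  refine (h.hasSum_apply (v j)).unique ?_
  have : (lam j • v j) = (lam j * ⟪v j, v j⟫) • v j := by
    rw [real_inner_self_eq_norm_sq, h.norm_eq_one hj]; simp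
  rw [this]
  refine hasSum_single j fun i hij => ?_
  by_cases hi : lam i = 0
  · simp [hi]
  · have := h.orthonormal.2 (i := ⟨i, hi⟩) (j := ⟨j, hj⟩) (by simpa using hij)
    simp only at this
    simp [this]

lemma hasSum_quadratic (h : IsEigendecomposition T lam v) (u : E) :
    HasSum (fun i => lam i * ⟪v i, u⟫ ^ 2) ⟪u, T u⟫ := by
  have := (h.hasSum_apply u).mapL (innerSL ℝ u)
  have heq : ∀ i, lam i * ⟪v i, u⟫ ^ 2 = innerSL ℝ u ((lam i * ⟪v i, u⟫) • v i) := fun i => by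
    rw [innerSL_apply_apply, inner_smul_right, real_inner_comm (v i) u, sq, mul_assoc]
  simpa only [heq, innerSL_apply_apply] using this

/-- In the double series of `lam i * ⟪v i, b e⟫ ^ 2`, Parseval sums over `e` to `lam i`, while the
sum over `i` is `⟪b e, T (b e)⟫`. The terms are nonnegative, so the order of summation can be
exchanged. -/
lemma trace_eq [CompleteSpace E] (h : IsEigendecomposition T lam v) (hs : Summable lam) :
    trace T = ∑' i, lam i := by
  obtain ⟨b, hb⟩ := (exists_hilbertBasis ℝ E).choose_spec
  have hrow : ∀ i, HasSum (fun e => lam i * ⟪v i, b e⟫ ^ 2) (lam i) := by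
    intro i
    by_cases hi : lam i = 0
    · simp [hi, hasSum_zero]
    · have := (b.hasSum_inner_mul_inner (v i) (v i)).mul_left (lam i)
      rw [real_inner_self_eq_norm_sq, h.norm_eq_one hi] at this
      simp only [one_pow, mul_one] at this
      have heq : ∀ e, lam i * ⟪v i, b e⟫ ^ 2 = lam i * (⟪v i, b e⟫ * ⟪b e, v i⟫) := fun e => by
        rw [real_inner_comm (v i) (b e), sq]
      simpa only [heq] using this
  have hsum : Summable (Function.uncurry fun i e => lam i * ⟪v i, b e⟫ ^ 2) := by
    refine (summable_prod_of_nonneg fun p => ?_).2 ⟨fun i => (hrow i).summable, ?_⟩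
    · exact mul_nonneg (h.nonneg _) (sq_nonneg _)
    · simpa [Function.uncurry, (hrow _).tsum_eq] using hs
  have hcomm := hsum.tsum_comm
  simp only [(hrow _).tsum_eq] at hcomm
  rw [← hcomm]
  unfold trace
  refine tsum_congr fun e => ?_
  rw [(h.hasSum_quadratic (b e)).tsum_eq, hb]

end IsEigendecomposition

end Eigen

end Operators

/-! ### Moment conditions as scalar inequalities -/

section Moments

variable {E : Type*} [NormedAddCommGroup E] [InnerProductSpace ℝ E] [CompleteSpace E]
  [SecondCountableTopology E] [MeasurableSpace E] [BorelSpace E]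
  {𝒟 : Measure (E × ℝ)} {α : ℝ}

namespace RegularityCondition

omit [CompleteSpace E] in
lemma integrable_outer (h : RegularityCondition 𝒟) :
    Integrable (fun z : E × ℝ => outer z.1) 𝒟 := by
  refine h.second_moment.mono' (continuous_outer.comp continuous_fst).aestronglyMeasurable ?_
  exact Filter.Eventually.of_forall fun z => (norm_outer z.1).le

lemma inner_secondMoment (h : RegularityCondition 𝒟) (u w : E) :
    ⟪u, secondMoment 𝒟 w⟫ = ∫ z, ⟪z.1, u⟫ * ⟪z.1, w⟫ ∂𝒟 := by
  unfold secondMoment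
  rw [ContinuousLinearMap.integral_apply h.integrable_outer,
    ← integral_inner (h.integrable_outer.apply_continuousLinearMap w)]
  refine integral_congr_ae (Filter.Eventually.of_forall fun z => ?_)
  simp only [outer_apply, inner_smul_right, real_inner_comm z.1 u]
  ring

lemma inner_secondMoment_self (h : RegularityCondition 𝒟) (u : E) :
    ⟪u, secondMoment 𝒟 u⟫ = ∫ z, ⟪z.1, u⟫ ^ 2 ∂𝒟 := by
  simp only [h.inner_secondMoment, sq]

omit [CompleteSpace E] in
lemma integrable_inner_mul (h : RegularityCondition 𝒟) (u w : E) :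
    Integrable (fun z : E × ℝ => ⟪z.1, u⟫ * ⟪z.1, w⟫) 𝒟 := by
  refine (h.second_moment.mul_const (‖u‖ * ‖w‖)).mono' (by fun_prop) ?_
  refine Filter.Eventually.of_forall fun z => ?_
  rw [norm_mul]
  calc ‖⟪z.1, u⟫‖ * ‖⟪z.1, w⟫‖ ≤ (‖z.1‖ * ‖u‖) * (‖z.1‖ * ‖w‖) := by
        gcongr <;> exact norm_inner_le_norm _ _
    _ = _ := by ring

omit [CompleteSpace E] in
lemma integrable_inner_sq (h : RegularityCondition 𝒟) (u : E) :
    Integrable (fun z : E × ℝ => ⟪z.1, u⟫ ^ 2) 𝒟 := by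
  simpa only [sq] using h.integrable_inner_mul u u

/-- Each nonzero eigenvalue is `𝔼⟪v i, x⟫²`, so Bessel's inequality bounds the partial sums by
`𝔼‖x‖²`. Indices with `lam i = 0` are masked because `v i` is arbitrary there. -/
lemma summable_eigenvalues (h : RegularityCondition 𝒟) {lam : ℕ → ℝ} {v : ℕ → E}
    (heig : IsEigendecomposition (secondMoment 𝒟) lam v) : Summable lam := by
  refine summable_of_sum_range_le (c := ∫ z, ‖z.1‖ ^ 2 ∂𝒟) heig.nonneg fun n => ?_
  classical
  have hlam : ∀ i, lam i = ∫ z, (if lam i ≠ 0 then ⟪v i, z.1⟫ ^ 2 else 0) ∂𝒟 := by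
    intro i
    by_cases hi : lam i = 0
    · simp [hi]
    · have := h.inner_secondMoment_self (v i)
      rw [heig.apply_eq hi, inner_smul_right, real_inner_self_eq_norm_sq,
        heig.norm_eq_one hi] at this
      simp only [ne_eq, hi, not_false_eq_true, if_true]
      simpa [real_inner_comm] using this
  have hint : ∀ i, Integrable (fun z : E × ℝ => if lam i ≠ 0 then ⟪v i, z.1⟫ ^ 2 else 0) 𝒟 := by
    intro i
    by_cases hi : lam i = 0
    · simp [hi]
    · simpa [hi, real_inner_comm] using h.integrable_inner_sq (v i)
  rw [Finset.sum_congr rfl fun i _ => hlam i, ← integral_finsetSum _ fun i _ => hint i]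
  refine integral_mono (integrable_finsetSum _ fun i _ => hint i) h.second_moment fun z => ?_
  have := heig.orthonormal.sum_inner_products_le z.1
    (s := (Finset.range n).subtype fun i => lam i ≠ 0)
  simp only [Real.norm_eq_abs, sq_abs] at this
  refine le_trans (le_of_eq ?_) this
  rw [Finset.sum_subtype_eq_sum_filter (f := fun i => ⟪v i, z.1⟫ ^ 2), Finset.sum_filter]

end RegularityCondition

lemma FourthMomentCondition.le (h : FourthMomentCondition 𝒟 α) (hreg : RegularityCondition 𝒟)
    {A : E →L[ℝ] E} (hA : A.IsPositive) (u : E) :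
    ∫ z, ⟪z.1, u⟫ ^ 2 * ⟪z.1, A z.1⟫ ∂𝒟 ≤
      α * trace (secondMoment 𝒟 ∘L A) * ⟪u, secondMoment 𝒟 u⟫ := by
  have hint : Integrable (fun z : E × ℝ => outer z.1 ∘L A ∘L outer z.1) 𝒟 := by
    refine (hreg.fourth_moment.const_mul ‖A‖).mono' ?_ ?_
    · have := (continuous_outer (E := E)).comp (continuous_fst (X := E) (Y := ℝ))
      exact (this.clm_comp (continuous_const.clm_comp this)).aestronglyMeasurable
    · refine Filter.Eventually.of_forall fun z => ?_
      calc ‖outer z.1 ∘L A ∘L outer z.1‖ ≤ ‖outer z.1‖ * (‖A‖ * ‖outer z.1‖) :=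
            (ContinuousLinearMap.opNorm_comp_le _ _).trans
              (mul_le_mul_of_nonneg_left (ContinuousLinearMap.opNorm_comp_le _ _) (norm_nonneg _))
        _ = ‖A‖ * ‖z.1‖ ^ 4 := by rw [norm_outer]; ring
  have := ((ContinuousLinearMap.le_def _ _).1 (h A hA)).inner_nonneg_right u
  rw [sub_apply, inner_sub_right, smul_apply,
    inner_smul_right, ContinuousLinearMap.integral_apply hint,
    ← integral_inner (hint.apply_continuousLinearMap u), sub_nonneg] at this
  refine le_trans (le_of_eq ?_) this
  refine integral_congr_ae (Filter.Eventually.of_forall fun z => ?_)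
  simp only [ContinuousLinearMap.comp_apply, outer_apply, inner_smul_right, map_smul,
    real_inner_comm z.1 u, smul_smul]
  ring

/-- The case `A = w wᵀ`, where `tr(HA) = ⟪w, Hw⟫`. It controls the multiplicative noise in the
variance recursion. -/
lemma FourthMomentCondition.inner_sq_mul_inner_sq_le (h : FourthMomentCondition 𝒟 α)
    (hreg : RegularityCondition 𝒟) (u w : E) :
    ∫ z, ⟪z.1, u⟫ ^ 2 * ⟪z.1, w⟫ ^ 2 ∂𝒟 ≤
      α * ⟪w, secondMoment 𝒟 w⟫ * ⟪u, secondMoment 𝒟 u⟫ := by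
  have := h.le hreg (outer_isPositive w) u
  rw [trace_comp_outer] at this
  refine le_trans (le_of_eq ?_) this
  refine integral_congr_ae (Filter.Eventually.of_forall fun z => ?_)
  simp only [outer_apply, inner_smul_right, real_inner_comm z.1 w]
  ring

/-- The case `A = I`, which controls the growth of the squared norm in the bias recursion. -/
lemma FourthMomentCondition.inner_sq_mul_norm_sq_le (h : FourthMomentCondition 𝒟 α)
    (hreg : RegularityCondition 𝒟) (u : E) :
    ∫ z, ⟪z.1, u⟫ ^ 2 * ‖z.1‖ ^ 2 ∂𝒟 ≤
      α * trace (secondMoment 𝒟) * ⟪u, secondMoment 𝒟 u⟫ := by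
  have := h.le hreg (A := 1) ContinuousLinearMap.isPositive_one u
  simpa [ContinuousLinearMap.one_def, real_inner_self_eq_norm_sq] using this

omit [CompleteSpace E] in
lemma RegularityCondition.integrable_fourth (h : RegularityCondition 𝒟) (a b c d : E) :
    Integrable (fun z : E × ℝ => ⟪z.1, a⟫ * ⟪z.1, b⟫ * (⟪z.1, c⟫ * ⟪z.1, d⟫)) 𝒟 := by
  refine (h.fourth_moment.mul_const (‖a‖ * ‖b‖ * (‖c‖ * ‖d‖))).mono' (by fun_prop) ?_
  refine Filter.Eventually.of_forall fun z => ?_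
  simp only [norm_mul]
  calc ‖⟪z.1, a⟫‖ * ‖⟪z.1, b⟫‖ * (‖⟪z.1, c⟫‖ * ‖⟪z.1, d⟫‖)
      ≤ (‖z.1‖ * ‖a‖) * (‖z.1‖ * ‖b‖) * ((‖z.1‖ * ‖c‖) * (‖z.1‖ * ‖d‖)) := by
        gcongr <;> exact norm_inner_le_norm _ _
    _ = _ := by ring

/-- Nonnegativity of the variance of `⟪x, u⟫²` gives `q² ≤ 𝔼⟪x, u⟫⁴ ≤ α q²` with `q = ⟪u, Hu⟫ > 0`.
This is what makes the step size small enough that `γλ_i ≤ 1`. -/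
lemma FourthMomentCondition.one_le [IsProbabilityMeasure 𝒟] [Nontrivial E]
    (h : FourthMomentCondition 𝒟 α) (hreg : RegularityCondition 𝒟) : 1 ≤ α := by
  obtain ⟨u, hu⟩ := exists_ne (0 : E)
  have hpos := hreg.posDef u hu
  set q := ⟪u, secondMoment 𝒟 u⟫ with hq
  have h1 := h.inner_sq_mul_inner_sq_le hreg u u
  have h2 : 0 ≤ ∫ z, (⟪z.1, u⟫ ^ 2 - q) ^ 2 ∂𝒟 := integral_nonneg fun z => sq_nonneg _
  have hi4 : Integrable (fun z : E × ℝ => ⟪z.1, u⟫ ^ 2 * ⟪z.1, u⟫ ^ 2) 𝒟 := by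
    simpa only [sq] using hreg.integrable_fourth u u u u
  have h3 : ∫ z, (⟪z.1, u⟫ ^ 2 - q) ^ 2 ∂𝒟
      = (∫ z, ⟪z.1, u⟫ ^ 2 * ⟪z.1, u⟫ ^ 2 ∂𝒟) - 2 * q * q + q ^ 2 := by
    have : ∀ z : E × ℝ, (⟪z.1, u⟫ ^ 2 - q) ^ 2
        = (⟪z.1, u⟫ ^ 2 * ⟪z.1, u⟫ ^ 2 - 2 * q * ⟪z.1, u⟫ ^ 2) + q ^ 2 := fun z => by ring
    simp only [this]
    have hi2 := (hreg.integrable_inner_sq u).const_mul (2 * q)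
    rw [integral_add (f := fun z : E × ℝ => ⟪z.1, u⟫ ^ 2 * ⟪z.1, u⟫ ^ 2 - 2 * q * ⟪z.1, u⟫ ^ 2)
      (hi4.sub hi2) (integrable_const _), integral_sub hi4 hi2, integral_const_mul,
      ← hreg.inner_secondMoment_self]
    simp [hq]
  have h4 : q ^ 2 ≤ α * q ^ 2 := by rw [h3] at h2; nlinarith
  exact le_of_mul_le_mul_right (by simpa using h4) (pow_pos hpos 2)

end Moments

/-! ### Independence of past and present -/

section Independence

variable {Ω X β : Type*} [MeasurableSpace Ω] [MeasurableSpace X] [MeasurableSpace β]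
  {P : Measure Ω} [IsProbabilityMeasure P] {𝒟 : Measure X} [IsProbabilityMeasure 𝒟]

/-- Fubini's theorem for a function of two independent random elements which is dominated by a
product. -/
lemma integral_of_indepFun {Y : Ω → β} {W : Ω → X} (hY : Measurable Y) (hW : Measurable W)
    (hlaw : P.map W = 𝒟) (hind : IndepFun Y W P) {F : β × X → ℝ} (hF : Measurable F)
    {f : β → ℝ} (hfm : Measurable f) (hf : Integrable (fun ω => f (Y ω)) P)
    {g : X → ℝ} (hg : Integrable g 𝒟) (hle : ∀ y z, |F (y, z)| ≤ f y * g z) :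
    Integrable (fun ω => F (Y ω, W ω)) P ∧ Integrable (fun ω => ∫ z, F (Y ω, z) ∂𝒟) P ∧
      ∫ ω, F (Y ω, W ω) ∂P = ∫ ω, ∫ z, F (Y ω, z) ∂𝒟 ∂P := by
  have hprod := (indepFun_iff_map_prod_eq_prod_map_map hY.aemeasurable hW.aemeasurable).1 hind
  rw [hlaw] at hprod
  have := Measure.isProbabilityMeasure_map (μ := P) hY.aemeasurable
  have hf' : Integrable f (P.map Y) :=
    (integrable_map_measure hfm.aestronglyMeasurable hY.aemeasurable).2 hf
  have hint : Integrable F ((P.map Y).prod 𝒟) :=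
    (hf'.mul_prod hg).mono' hF.aestronglyMeasurable
      (Filter.Eventually.of_forall fun p => hle p.1 p.2)
  have hpair : Measurable fun ω => (Y ω, W ω) := hY.prodMk hW
  refine ⟨?_, ?_, ?_⟩
  · rw [← hprod] at hint
    exact (integrable_map_measure hint.aestronglyMeasurable hpair.aemeasurable).1 hint
  · have := hint.integral_prod_left
    exact (integrable_map_measure this.aestronglyMeasurable hY.aemeasurable).1 this
  · have h1 := integral_map (μ := P) hpair.aemeasurable (f := F) hF.aestronglyMeasurable
    rw [← h1, hprod, integral_prod _ hint]
    exact integral_map hY.aemeasurable hint.integral_prod_left.aestronglyMeasurable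

omit [IsProbabilityMeasure P] in
/-- In an independent sequence, a function of the first `t` terms is independent of term `t`. -/
lemma indepFun_of_past [Nonempty X] {Z : ℕ → Ω → X} (hmeas : ∀ t, Measurable (Z t))
    (hindep : iIndepFun Z P) {g : (ℕ → X) → β} (hg : Measurable g) {t : ℕ}
    (hdep : ∀ z z' : ℕ → X, (∀ i < t, z i = z' i) → g z = g z') :
    IndepFun (fun ω => g fun i => Z i ω) (Z t) P := by
  have h := hindep.indepFun_finset (Finset.range t) {t} (by simp) hmeas
  -- A finite history is padded to a full sequence; the padding value is irrelevant since `g`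
  -- depends only on indices below `t`.
  let ext : (Finset.range t → X) → ℕ → X :=
    fun p i => if hi : i ∈ Finset.range t then p ⟨i, hi⟩ else Classical.arbitrary X
  have hext : Measurable ext := by
    refine measurable_pi_lambda _ fun i => ?_
    by_cases hi : i ∈ Finset.range t
    · simp only [ext, hi, dif_pos]
      exact measurable_pi_apply _
    · simp only [ext, hi, dif_neg, not_false_eq_true]
      exact measurable_const
  have h2 := h.comp (hg.comp hext)
    (measurable_pi_apply (⟨t, Finset.mem_singleton_self t⟩ : ({t} : Finset ℕ)))
  refine (h2.congr ?_ ?_)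
  · refine Filter.Eventually.of_forall fun ω => ?_
    refine hdep _ _ fun i hi => ?_
    simp [ext, hi]
  · exact Filter.Eventually.of_forall fun ω => rfl

end Independence

/-! ### One step of the recursion -/

section OneStep

variable {E : Type*} [NormedAddCommGroup E] [InnerProductSpace ℝ E] [CompleteSpace E]
  [SecondCountableTopology E] [MeasurableSpace E] [BorelSpace E]
  {𝒟 : Measure (E × ℝ)} {α : ℝ}

/-- `ξ` is a noise for the distribution `𝒟`: `ξ x` is square integrable and centred, and
`𝔼[ξ² x xᵀ] ≼ s H`. -/
structure IsNoise (𝒟 : Measure (E × ℝ)) (ξ : E × ℝ → ℝ) (s : ℝ) : Prop where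
  measurable : Measurable ξ
  integrable_sq : Integrable (fun z : E × ℝ => ξ z ^ 2 * ‖z.1‖ ^ 2) 𝒟
  centred : ∀ u : E, ∫ z, ξ z * ⟪z.1, u⟫ ∂𝒟 = 0
  sq_le : ∀ u : E, ∫ z, ξ z ^ 2 * ⟪z.1, u⟫ ^ 2 ∂𝒟 ≤ s * ⟪u, secondMoment 𝒟 u⟫

omit [CompleteSpace E] [SecondCountableTopology E] [BorelSpace E] in
lemma isNoise_zero : IsNoise 𝒟 (fun _ => 0) 0 where
  measurable := measurable_const
  integrable_sq := by simp
  centred := by simp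
  sq_le := by simp

omit [CompleteSpace E] in
lemma IsNoise.integrable_mul_norm [IsProbabilityMeasure 𝒟] {ξ : E × ℝ → ℝ} {s : ℝ}
    (h : IsNoise 𝒟 ξ s) : Integrable (fun z : E × ℝ => |ξ z| * ‖z.1‖) 𝒟 := by
  have := h.measurable
  refine ((integrable_const (1 : ℝ)).add h.integrable_sq).mono' (by fun_prop) ?_
  refine Filter.Eventually.of_forall fun z => ?_
  rw [Real.norm_of_nonneg (by positivity)]
  simp only [Pi.add_apply]
  nlinarith [sq_nonneg (|ξ z| * ‖z.1‖ - 1), sq_abs (ξ z)]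

omit [CompleteSpace E] in
lemma IsNoise.integrable_mul_norm_cube {ξ : E × ℝ → ℝ} {s : ℝ}
    (h : IsNoise 𝒟 ξ s) (hreg : RegularityCondition 𝒟) :
    Integrable (fun z : E × ℝ => |ξ z| * ‖z.1‖ ^ 3) 𝒟 := by
  have := h.measurable
  refine (h.integrable_sq.add hreg.fourth_moment).mono' (by fun_prop) ?_
  refine Filter.Eventually.of_forall fun z => ?_
  rw [Real.norm_of_nonneg (by positivity)]
  simp only [Pi.add_apply]
  nlinarith [sq_nonneg (|ξ z| * ‖z.1‖ - ‖z.1‖ ^ 2), sq_abs (ξ z),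
    sq_nonneg (|ξ z| * ‖z.1‖), sq_nonneg (‖z.1‖ ^ 2)]

/-- The update `u ↦ u + γ (ξ - ⟪u, x⟫) x`. -/
def sgdStep (γ : ℝ) (u x : E) (r : ℝ) : E := u + (γ * (r - ⟪u, x⟫)) • x

variable {Ω : Type*} [MeasurableSpace Ω] {P : Measure Ω} [IsProbabilityMeasure P]
  [IsProbabilityMeasure 𝒟] {W : Ω → E × ℝ} {Y : Ω → E} {γ s : ℝ} {ξ : E × ℝ → ℝ}

omit [CompleteSpace E] [SecondCountableTopology E] [BorelSpace E] [MeasurableSpace E] in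
-- A crude bound, valid for every `γ`, that serves only to propagate square integrability.
lemma norm_sgdStep_sq_le (γ : ℝ) (u x : E) (r : ℝ) :
    ‖sgdStep γ u x r‖ ^ 2 ≤
      2 * (‖u‖ ^ 2 * (1 + |γ| * ‖x‖ ^ 2) ^ 2) + 2 * (γ ^ 2 * (r ^ 2 * ‖x‖ ^ 2)) := by
  have h1 : sgdStep γ u x r = (u - (γ * ⟪u, x⟫) • x) + (γ * r) • x := by
    unfold sgdStep; module
  have h2 : ‖u - (γ * ⟪u, x⟫) • x‖ ≤ ‖u‖ * (1 + |γ| * ‖x‖ ^ 2) := by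
    refine (norm_sub_le _ _).trans ?_
    rw [norm_smul, norm_mul, Real.norm_eq_abs γ]
    have := norm_inner_le_norm (𝕜 := ℝ) u x
    calc ‖u‖ + |γ| * ‖⟪u, x⟫‖ * ‖x‖ ≤ ‖u‖ + |γ| * (‖u‖ * ‖x‖) * ‖x‖ := by gcongr
      _ = _ := by ring
  have h3 : ‖(γ * r) • x‖ ^ 2 = γ ^ 2 * (r ^ 2 * ‖x‖ ^ 2) := by
    rw [norm_smul, mul_pow, Real.norm_eq_abs, sq_abs]; ring
  have h4 : ‖sgdStep γ u x r‖ ^ 2 ≤ 2 * (‖u - (γ * ⟪u, x⟫) • x‖ ^ 2 + ‖(γ * r) • x‖ ^ 2) := by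
    rw [h1]
    refine (pow_le_pow_left₀ (norm_nonneg _) (norm_add_le _ _) 2).trans (add_sq_le)
  have h5 := pow_le_pow_left₀ (norm_nonneg _) h2 2
  rw [h3] at h4
  rw [mul_pow] at h5
  linarith

omit [CompleteSpace E] in
lemma integrable_norm_sgdStep_sq (hreg : RegularityCondition 𝒟) (hξ : IsNoise 𝒟 ξ s)
    (hY : Measurable Y) (hW : Measurable W) (hlaw : P.map W = 𝒟) (hind : IndepFun Y W P)
    (hYint : Integrable (fun ω => ‖Y ω‖ ^ 2) P) :
    Integrable (fun ω => ‖sgdStep γ (Y ω) (W ω).1 (ξ (W ω))‖ ^ 2) P := by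
  have hm := hξ.measurable
  have h1 := (integral_of_indepFun hY hW hlaw hind
    (F := fun p => 2 * (‖p.1‖ ^ 2 * (1 + |γ| * ‖p.2.1‖ ^ 2) ^ 2)) (by fun_prop)
    (f := fun y => ‖y‖ ^ 2) (by fun_prop) hYint
    (g := fun z => 2 * (1 + |γ| * ‖z.1‖ ^ 2) ^ 2) ?_ ?_).1
  · have h2 : Integrable (fun ω => 2 * (γ ^ 2 * (ξ (W ω) ^ 2 * ‖(W ω).1‖ ^ 2))) P := by
      refine ((?_ : Integrable _ _).const_mul _).const_mul _
      have := hξ.integrable_sq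
      rw [← hlaw] at this
      exact (integrable_map_measure this.aestronglyMeasurable hW.aemeasurable).1 this
    refine (h1.add h2).mono' ?_ ?_
    · unfold sgdStep
      exact Measurable.aestronglyMeasurable (by fun_prop)
    · refine Filter.Eventually.of_forall fun ω => ?_
      rw [Real.norm_of_nonneg (by positivity)]
      exact norm_sgdStep_sq_le _ _ _ _
  · refine Integrable.const_mul ?_ 2
    have : ∀ z : E × ℝ, (1 + |γ| * ‖z.1‖ ^ 2) ^ 2
        = 1 + (2 * |γ|) * ‖z.1‖ ^ 2 + γ ^ 2 * ‖z.1‖ ^ 4 := fun z => by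
      rw [← sq_abs γ]; ring
    simp only [this]
    exact ((integrable_const _).add (hreg.second_moment.const_mul _)).add
      (hreg.fourth_moment.const_mul _)
  · intro y z
    rw [abs_of_nonneg (by positivity)]
    exact le_of_eq (by ring)

omit [CompleteSpace E] [IsProbabilityMeasure P] in
lemma integrable_inner_sq_of_norm_sq (hY : Measurable Y)
    (hYint : Integrable (fun ω => ‖Y ω‖ ^ 2) P) (u : E) :
    Integrable (fun ω => ⟪u, Y ω⟫ ^ 2) P := by
  refine (hYint.const_mul (‖u‖ ^ 2)).mono' (Measurable.aestronglyMeasurable (by fun_prop)) ?_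
  refine Filter.Eventually.of_forall fun ω => ?_
  rw [norm_pow, ← mul_pow]
  gcongr
  exact norm_inner_le_norm _ _

omit [CompleteSpace E] [IsProbabilityMeasure P] in
lemma integrable_mul_inner {S : Ω → ℝ} (hS : Measurable S) (hY : Measurable Y)
    (hSint : Integrable (fun ω => S ω ^ 2) P)
    (hYint : Integrable (fun ω => ‖Y ω‖ ^ 2) P) (u : E) :
    Integrable (fun ω => S ω * ⟪u, Y ω⟫) P := by
  refine (hSint.add (integrable_inner_sq_of_norm_sq hY hYint u)).mono'
    (Measurable.aestronglyMeasurable (by fun_prop)) ?_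
  refine Filter.Eventually.of_forall fun ω => ?_
  rw [norm_mul, Real.norm_eq_abs, Real.norm_eq_abs]
  simp only [Pi.add_apply]
  rw [← sq_abs (S ω), ← sq_abs ⟪u, Y ω⟫]
  nlinarith [sq_nonneg (|S ω| - |⟪u, Y ω⟫|), sq_nonneg (|S ω|), sq_nonneg (|⟪u, Y ω⟫|)]

omit [InnerProductSpace ℝ E] [CompleteSpace E] [SecondCountableTopology E]
  [IsProbabilityMeasure P] in
lemma integrable_mul_norm_of_sq {S : Ω → ℝ} (hS : Measurable S) (hY : Measurable Y)
    (hSint : Integrable (fun ω => S ω ^ 2) P)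
    (hYint : Integrable (fun ω => ‖Y ω‖ ^ 2) P) :
    Integrable (fun ω => |S ω| * ‖Y ω‖) P := by
  refine (hSint.add hYint).mono' (Measurable.aestronglyMeasurable (by fun_prop)) ?_
  refine Filter.Eventually.of_forall fun ω => ?_
  rw [Real.norm_of_nonneg (by positivity)]
  simp only [Pi.add_apply]
  rw [← sq_abs (S ω)]
  nlinarith [sq_nonneg (|S ω| - ‖Y ω‖), sq_nonneg (|S ω|), sq_nonneg (‖Y ω‖)]

/-- The conditional mean of a step is `I - γ H`. -/
lemma integral_mul_inner_sgdStep (hreg : RegularityCondition 𝒟) (hξ : IsNoise 𝒟 ξ s)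
    {S : Ω → ℝ} (hS : Measurable S)
    (hY : Measurable Y) (hW : Measurable W) (hlaw : P.map W = 𝒟)
    (hind : IndepFun (fun ω => (S ω, Y ω)) W P)
    (hSint : Integrable (fun ω => S ω ^ 2) P)
    (hYint : Integrable (fun ω => ‖Y ω‖ ^ 2) P) (u : E) :
    ∫ ω, S ω * ⟪u, sgdStep γ (Y ω) (W ω).1 (ξ (W ω))⟫ ∂P =
      ∫ ω, S ω * ⟪u, Y ω⟫ ∂P - γ * ∫ ω, S ω * ⟪secondMoment 𝒟 u, Y ω⟫ ∂P := by
  have hm := hξ.measurable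
  have hSabs : Integrable (fun ω => |S ω|) P := by
    refine ((integrable_const (1 : ℝ)).add hSint).mono'
      (Measurable.aestronglyMeasurable (by fun_prop)) ?_
    refine Filter.Eventually.of_forall fun ω => ?_
    simp only [Pi.add_apply, norm_abs_eq_norm, Real.norm_eq_abs]
    nlinarith [sq_nonneg (|S ω| - 1), sq_abs (S ω)]
  obtain ⟨i1, -, e1⟩ := integral_of_indepFun (hS.prodMk hY) hW hlaw hind
    (F := fun p => p.1.1 * (⟪p.2.1, p.1.2⟫ * ⟪p.2.1, u⟫)) (by fun_prop)
    (f := fun y => |y.1| * ‖y.2‖) (by fun_prop) (integrable_mul_norm_of_sq hS hY hSint hYint)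
    (hreg.second_moment.mul_const ‖u‖) (fun y z => by
      rw [abs_mul, abs_mul, mul_assoc]
      refine mul_le_mul_of_nonneg_left ?_ (abs_nonneg _)
      calc |⟪z.1, y.2⟫| * |⟪z.1, u⟫| ≤ (‖z.1‖ * ‖y.2‖) * (‖z.1‖ * ‖u‖) := by
            gcongr <;> exact abs_real_inner_le_norm _ _
        _ = _ := by ring)
  obtain ⟨i2, -, e2⟩ := integral_of_indepFun (hS.prodMk hY) hW hlaw hind
    (F := fun p => p.1.1 * (ξ p.2 * ⟪p.2.1, u⟫)) (by fun_prop)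
    (f := fun y => |y.1|) (by fun_prop) hSabs
    (hξ.integrable_mul_norm.mul_const ‖u‖) (fun y z => by
      rw [abs_mul, abs_mul, mul_assoc]
      gcongr
      exact abs_real_inner_le_norm _ _)
  -- Integrating out the fresh sample kills the centred noise and turns `x xᵀ` into `H`.
  simp only [integral_const_mul, hξ.centred, mul_zero, integral_zero] at e2
  simp only [integral_const_mul, ← hreg.inner_secondMoment] at e1
  have i0 := integrable_mul_inner hS hY hSint hYint u
  have hexp : ∀ ω, S ω * ⟪u, sgdStep γ (Y ω) (W ω).1 (ξ (W ω))⟫ =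
      S ω * ⟪u, Y ω⟫ + γ * (S ω * (ξ (W ω) * ⟪(W ω).1, u⟫))
        - γ * (S ω * (⟪(W ω).1, Y ω⟫ * ⟪(W ω).1, u⟫)) := by
    intro ω
    simp only [sgdStep, inner_add_right, inner_smul_right, real_inner_comm (W ω).1 u,
      real_inner_comm (W ω).1 (Y ω)]
    ring
  simp only [hexp]
  rw [integral_sub (f := fun ω => S ω * ⟪u, Y ω⟫ + γ * (S ω * (ξ (W ω) * ⟪(W ω).1, u⟫)))
    (i0.add (i2.const_mul γ)) (i1.const_mul γ), integral_add i0 (i2.const_mul γ),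
    integral_const_mul, integral_const_mul, e1, e2]
  simp only [mul_zero, add_zero, real_inner_comm]

omit [CompleteSpace E] [IsProbabilityMeasure P] [IsProbabilityMeasure 𝒟] in
lemma integrable_quadratic (hY : Measurable Y) (hYint : Integrable (fun ω => ‖Y ω‖ ^ 2) P) :
    Integrable (fun ω => ⟪Y ω, secondMoment 𝒟 (Y ω)⟫) P := by
  refine (hYint.const_mul ‖secondMoment 𝒟‖).mono'
    (Measurable.aestronglyMeasurable (by fun_prop)) ?_
  refine Filter.Eventually.of_forall fun ω => (norm_inner_le_norm _ _).trans ?_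
  calc ‖Y ω‖ * ‖secondMoment 𝒟 (Y ω)‖ ≤ ‖Y ω‖ * (‖secondMoment 𝒟‖ * ‖Y ω‖) := by
        gcongr; exact (secondMoment 𝒟).le_opNorm _
    _ = _ := by ring

/-- One step of the second moment recursion along an eigenvector of `H`. -/
lemma integral_inner_sgdStep_sq_le (hreg : RegularityCondition 𝒟)
    (hfourth : FourthMomentCondition 𝒟 α) (hξ : IsNoise 𝒟 ξ s)
    (hY : Measurable Y) (hW : Measurable W) (hlaw : P.map W = 𝒟) (hind : IndepFun Y W P)
    (hYint : Integrable (fun ω => ‖Y ω‖ ^ 2) P) (hzero : ∀ u, ∫ ω, ⟪u, Y ω⟫ ∂P = 0)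
    {v : E} {l : ℝ} (hv : ‖v‖ = 1) (hl : secondMoment 𝒟 v = l • v) :
    ∫ ω, ⟪v, sgdStep γ (Y ω) (W ω).1 (ξ (W ω))⟫ ^ 2 ∂P ≤
      (1 - 2 * γ * l) * ∫ ω, ⟪v, Y ω⟫ ^ 2 ∂P +
        γ ^ 2 * l * (α * ∫ ω, ⟪Y ω, secondMoment 𝒟 (Y ω)⟫ ∂P + s) := by
  have hm := hξ.measurable
  have hvl : ⟪v, secondMoment 𝒟 v⟫ = l := by
    rw [hl, inner_smul_right, real_inner_self_eq_norm_sq, hv]; simp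
  have hYn : Integrable (fun ω => ‖Y ω‖) P := by
    simpa using integrable_mul_norm_of_sq (S := fun _ => 1) measurable_const hY
      (by simp) hYint
  have hxv : ∀ x : E, |⟪x, v⟫| ≤ ‖x‖ := fun x => by
    simpa [hv] using abs_real_inner_le_norm x v
  have i1 := integrable_inner_sq_of_norm_sq hY hYint v
  -- the term `ξ² ⟪x, v⟫²`
  have i2' : Integrable (fun z : E × ℝ => ξ z ^ 2 * ⟪z.1, v⟫ ^ 2) 𝒟 := by
    refine hξ.integrable_sq.mono' (Measurable.aestronglyMeasurable (by fun_prop)) ?_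
    refine Filter.Eventually.of_forall fun z => ?_
    rw [Real.norm_of_nonneg (by positivity), ← sq_abs ⟪z.1, v⟫]
    gcongr
    exact hxv _
  have i2 : Integrable (fun ω => ξ (W ω) ^ 2 * ⟪(W ω).1, v⟫ ^ 2) P := by
    rw [← hlaw] at i2'
    exact (integrable_map_measure i2'.aestronglyMeasurable hW.aemeasurable).1 i2'
  have e2 : ∫ ω, ξ (W ω) ^ 2 * ⟪(W ω).1, v⟫ ^ 2 ∂P ≤ s * l := by
    have h := integral_map (μ := P) hW.aemeasurable
      (f := fun z : E × ℝ => ξ z ^ 2 * ⟪z.1, v⟫ ^ 2)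
      (Measurable.aestronglyMeasurable (by fun_prop))
    rw [← h, hlaw, ← hvl]
    exact hξ.sq_le v
  -- the term `⟪x, v⟫² ⟪x, Y⟫²`
  obtain ⟨i3, j3, e3⟩ := integral_of_indepFun hY hW hlaw hind
    (F := fun p => ⟪p.2.1, v⟫ ^ 2 * ⟪p.2.1, p.1⟫ ^ 2) (by fun_prop)
    (f := fun y => ‖y‖ ^ 2) (by fun_prop) hYint hreg.fourth_moment (fun y z => by
      rw [abs_of_nonneg (by positivity), ← sq_abs ⟪z.1, v⟫, ← sq_abs ⟪z.1, y⟫]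
      calc |⟪z.1, v⟫| ^ 2 * |⟪z.1, y⟫| ^ 2 ≤ ‖z.1‖ ^ 2 * (‖z.1‖ * ‖y‖) ^ 2 := by
            gcongr
            · exact hxv _
            · exact abs_real_inner_le_norm _ _
        _ = _ := by ring)
  have iQ := integrable_quadratic (𝒟 := 𝒟) hY hYint
  -- By independence `Y` can be frozen, and the fourth moment condition is applied with `A = Y Yᵀ`.
  have e3' : ∫ ω, ⟪(W ω).1, v⟫ ^ 2 * ⟪(W ω).1, Y ω⟫ ^ 2 ∂P ≤
      l * (α * ∫ ω, ⟪Y ω, secondMoment 𝒟 (Y ω)⟫ ∂P) := by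
    rw [e3, ← integral_const_mul, ← integral_const_mul]
    refine integral_mono j3 ((iQ.const_mul α).const_mul l) fun ω => ?_
    have := hfourth.inner_sq_mul_inner_sq_le hreg v (Y ω)
    rw [hvl] at this
    simpa [mul_comm, mul_left_comm] using this
  -- the term `⟪v, Y⟫ ξ ⟪x, v⟫`
  obtain ⟨i4, -, e4⟩ := integral_of_indepFun hY hW hlaw hind
    (F := fun p => ⟪v, p.1⟫ * (ξ p.2 * ⟪p.2.1, v⟫)) (by fun_prop)
    (f := fun y => ‖y‖) (by fun_prop) hYn hξ.integrable_mul_norm (fun y z => by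
      rw [abs_mul, abs_mul]
      gcongr
      · rw [real_inner_comm]; simpa [hv] using abs_real_inner_le_norm y v
      · exact hxv _)
  simp only [integral_const_mul, hξ.centred, mul_zero, integral_zero] at e4
  -- the term `⟪v, Y⟫ ⟪x, Y⟫ ⟪x, v⟫`
  obtain ⟨i5, -, e5⟩ := integral_of_indepFun hY hW hlaw hind
    (F := fun p => ⟪v, p.1⟫ * (⟪p.2.1, p.1⟫ * ⟪p.2.1, v⟫)) (by fun_prop)
    (f := fun y => ‖y‖ ^ 2) (by fun_prop) hYint hreg.second_moment (fun y z => by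
      rw [abs_mul, abs_mul]
      calc |⟪v, y⟫| * (|⟪z.1, y⟫| * |⟪z.1, v⟫|) ≤ ‖y‖ * ((‖z.1‖ * ‖y‖) * ‖z.1‖) := by
            gcongr
            · rw [real_inner_comm]; simpa [hv] using abs_real_inner_le_norm y v
            · exact abs_real_inner_le_norm _ _
            · exact hxv _
        _ = _ := by ring)
  simp only [integral_const_mul, ← hreg.inner_secondMoment, hl, inner_smul_right] at e5
  have e5' : ∫ ω, ⟪v, Y ω⟫ * (⟪(W ω).1, Y ω⟫ * ⟪(W ω).1, v⟫) ∂P = l * ∫ ω, ⟪v, Y ω⟫ ^ 2 ∂P := by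
    rw [e5, ← integral_const_mul]
    refine integral_congr_ae (Filter.Eventually.of_forall fun ω => ?_)
    simp only [real_inner_comm v (Y ω)]
    ring
  -- the term `ξ ⟪x, v⟫² ⟪x, Y⟫`
  obtain ⟨i6, -, e6⟩ := integral_of_indepFun hY hW hlaw hind
    (F := fun p => ⟪p.1, (ξ p.2 * ⟪p.2.1, v⟫ ^ 2) • p.2.1⟫) (by fun_prop)
    (f := fun y => ‖y‖) (by fun_prop) hYn (hξ.integrable_mul_norm_cube hreg) (fun y z => by
      refine (abs_real_inner_le_norm _ _).trans ?_
      gcongr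
      rw [norm_smul, norm_mul, Real.norm_eq_abs, norm_pow, Real.norm_eq_abs, mul_assoc]
      gcongr
      calc |⟪z.1, v⟫| ^ 2 * ‖z.1‖ ≤ ‖z.1‖ ^ 2 * ‖z.1‖ := by
            gcongr; exact hxv _
        _ = _ := by ring)
  have i6' : Integrable (fun z : E × ℝ => (ξ z * ⟪z.1, v⟫ ^ 2) • z.1) 𝒟 := by
    refine (hξ.integrable_mul_norm_cube hreg).mono'
      (Measurable.aestronglyMeasurable (by fun_prop)) ?_
    refine Filter.Eventually.of_forall fun z => ?_
    rw [norm_smul, norm_mul, Real.norm_eq_abs, norm_pow, Real.norm_eq_abs, mul_assoc]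
    gcongr
    calc |⟪z.1, v⟫| ^ 2 * ‖z.1‖ ≤ ‖z.1‖ ^ 2 * ‖z.1‖ := by
          gcongr; exact hxv _
      _ = _ := by ring
  -- The third-order moment of noise and data need not vanish, but this cross term is linear in `Y`,
  -- which has mean zero.
  have e6' : ∫ ω, ⟪Y ω, (ξ (W ω) * ⟪(W ω).1, v⟫ ^ 2) • (W ω).1⟫ ∂P = 0 := by
    rw [e6]
    simp only [integral_inner i6']
    simpa only [real_inner_comm] using hzero (∫ z, (ξ z * ⟪z.1, v⟫ ^ 2) • z.1 ∂𝒟)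
  have hexp : ∀ ω, ⟪v, sgdStep γ (Y ω) (W ω).1 (ξ (W ω))⟫ ^ 2 =
      ⟪v, Y ω⟫ ^ 2 + (γ ^ 2 * (ξ (W ω) ^ 2 * ⟪(W ω).1, v⟫ ^ 2) +
        (γ ^ 2 * (⟪(W ω).1, v⟫ ^ 2 * ⟪(W ω).1, Y ω⟫ ^ 2) +
        (2 * γ * (⟪v, Y ω⟫ * (ξ (W ω) * ⟪(W ω).1, v⟫)) +
        (-2 * γ * (⟪v, Y ω⟫ * (⟪(W ω).1, Y ω⟫ * ⟪(W ω).1, v⟫)) +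
        -2 * γ ^ 2 * ⟪Y ω, (ξ (W ω) * ⟪(W ω).1, v⟫ ^ 2) • (W ω).1⟫)))) := by
    intro ω
    simp only [sgdStep, inner_add_right, inner_smul_right, real_inner_comm (W ω).1 v,
      real_inner_comm (W ω).1 (Y ω)]
    ring
  simp only [hexp]
  have k5 := (i5.const_mul (-2 * γ)).add (i6.const_mul (-2 * γ ^ 2))
  have k4 := (i4.const_mul (2 * γ)).add k5
  have k3 := (i3.const_mul (γ ^ 2)).add k4
  have k2 := (i2.const_mul (γ ^ 2)).add k3
  erw [integral_add i1 k2, integral_add (i2.const_mul (γ ^ 2)) k3,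
    integral_add (i3.const_mul (γ ^ 2)) k4, integral_add (i4.const_mul (2 * γ)) k5,
    integral_add (i5.const_mul (-2 * γ)) (i6.const_mul (-2 * γ ^ 2))]
  simp only [integral_const_mul]
  rw [e4, e5', e6']
  have hg := sq_nonneg γ
  nlinarith [mul_le_mul_of_nonneg_left e2 hg, mul_le_mul_of_nonneg_left e3' hg]

/-- The expected squared norm decreases under a step without noise. -/
lemma integral_norm_sgdStep_zero_sq_le (hreg : RegularityCondition 𝒟)
    (hfourth : FourthMomentCondition 𝒟 α)
    (hY : Measurable Y) (hW : Measurable W) (hlaw : P.map W = 𝒟) (hind : IndepFun Y W P)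
    (hYint : Integrable (fun ω => ‖Y ω‖ ^ 2) P) :
    ∫ ω, ‖sgdStep γ (Y ω) (W ω).1 0‖ ^ 2 ∂P ≤ ∫ ω, ‖Y ω‖ ^ 2 ∂P -
      (2 * γ - γ ^ 2 * (α * trace (secondMoment 𝒟))) *
        ∫ ω, ⟪Y ω, secondMoment 𝒟 (Y ω)⟫ ∂P := by
  obtain ⟨i1, -, e1⟩ := integral_of_indepFun hY hW hlaw hind
    (F := fun p => ⟪p.2.1, p.1⟫ ^ 2) (by fun_prop)
    (f := fun y => ‖y‖ ^ 2) (by fun_prop) hYint hreg.second_moment (fun y z => by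
      rw [abs_of_nonneg (by positivity), ← mul_pow, ← sq_abs, mul_comm]
      gcongr
      exact abs_real_inner_le_norm _ _)
  obtain ⟨i2, j2, e2⟩ := integral_of_indepFun hY hW hlaw hind
    (F := fun p => ⟪p.2.1, p.1⟫ ^ 2 * ‖p.2.1‖ ^ 2) (by fun_prop)
    (f := fun y => ‖y‖ ^ 2) (by fun_prop) hYint hreg.fourth_moment (fun y z => by
      rw [abs_of_nonneg (by positivity), ← sq_abs ⟪z.1, y⟫]
      calc |⟪z.1, y⟫| ^ 2 * ‖z.1‖ ^ 2 ≤ (‖z.1‖ * ‖y‖) ^ 2 * ‖z.1‖ ^ 2 := by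
            gcongr; exact abs_real_inner_le_norm _ _
        _ = _ := by ring)
  have iQ := integrable_quadratic (𝒟 := 𝒟) hY hYint
  simp only [← hreg.inner_secondMoment_self] at e1
  have e2' : ∫ ω, ⟪(W ω).1, Y ω⟫ ^ 2 * ‖(W ω).1‖ ^ 2 ∂P ≤
      α * trace (secondMoment 𝒟) * ∫ ω, ⟪Y ω, secondMoment 𝒟 (Y ω)⟫ ∂P := by
    rw [e2, ← integral_const_mul]
    exact integral_mono j2 (iQ.const_mul _) fun ω => hfourth.inner_sq_mul_norm_sq_le hreg _
  have hexp : ∀ ω, ‖sgdStep γ (Y ω) (W ω).1 0‖ ^ 2 =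
      ‖Y ω‖ ^ 2 + (-2 * γ * ⟪(W ω).1, Y ω⟫ ^ 2 +
        γ ^ 2 * (⟪(W ω).1, Y ω⟫ ^ 2 * ‖(W ω).1‖ ^ 2)) := by
    intro ω
    rw [sgdStep, norm_add_sq_real, norm_smul, mul_pow, Real.norm_eq_abs, sq_abs,
      inner_smul_right, real_inner_comm (W ω).1 (Y ω)]
    ring
  simp only [hexp]
  have k1 := (i1.const_mul (-2 * γ)).add (i2.const_mul (γ ^ 2))
  erw [integral_add hYint k1, integral_add (i1.const_mul (-2 * γ)) (i2.const_mul (γ ^ 2))]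
  simp only [integral_const_mul]
  rw [e1]
  nlinarith [mul_le_mul_of_nonneg_left e2' (sq_nonneg γ)]

end OneStep

/-! ### Optimality of the minimizer and the residual noise -/

section Residual

variable {E : Type*} [NormedAddCommGroup E] [InnerProductSpace ℝ E] [CompleteSpace E]
  [SecondCountableTopology E] [MeasurableSpace E] [BorelSpace E]
  {𝒟 : Measure (E × ℝ)} {wstar : E} {σ : ℝ}

omit [CompleteSpace E] in
lemma RegularityCondition.integrable_residual_sq (hreg : RegularityCondition 𝒟) (w : E) :
    Integrable (fun z : E × ℝ => (z.2 - ⟪w, z.1⟫) ^ 2) 𝒟 := by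
  refine ((hreg.response.const_mul 2).add (hreg.second_moment.const_mul (2 * ‖w‖ ^ 2))).mono'
    (Measurable.aestronglyMeasurable (by fun_prop)) (Filter.Eventually.of_forall fun z => ?_)
  rw [Real.norm_of_nonneg (by positivity)]
  simp only [Pi.add_apply]
  have h := pow_le_pow_left₀ (abs_nonneg _) (abs_real_inner_le_norm w z.1) 2
  rw [sq_abs, mul_pow] at h
  nlinarith [sq_nonneg (z.2 + ⟪w, z.1⟫)]

omit [CompleteSpace E] in
lemma RegularityCondition.integrable_residual_mul (hreg : RegularityCondition 𝒟) (w u : E) :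
    Integrable (fun z : E × ℝ => (z.2 - ⟪w, z.1⟫) * ⟪z.1, u⟫) 𝒟 := by
  refine ((hreg.integrable_residual_sq w).add (hreg.integrable_inner_sq u)).mono'
    (Measurable.aestronglyMeasurable (by fun_prop)) (Filter.Eventually.of_forall fun z => ?_)
  simp only [Pi.add_apply, norm_mul, Real.norm_eq_abs]
  rw [← sq_abs (z.2 - ⟪w, z.1⟫), ← sq_abs ⟪z.1, u⟫]
  nlinarith [sq_nonneg (|z.2 - ⟪w, z.1⟫| - |⟪z.1, u⟫|), sq_nonneg |z.2 - ⟪w, z.1⟫|,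
    sq_nonneg |⟪z.1, u⟫|]

lemma RegularityCondition.risk_add (hreg : RegularityCondition 𝒟) (w u : E) :
    risk 𝒟 (w + u) = risk 𝒟 w - ∫ z, (z.2 - ⟪w, z.1⟫) * ⟪z.1, u⟫ ∂𝒟
      + (1 / 2) * ⟪u, secondMoment 𝒟 u⟫ := by
  have hexp : ∀ z : E × ℝ, (z.2 - ⟪w + u, z.1⟫) ^ 2 =
      (z.2 - ⟪w, z.1⟫) ^ 2 + (-2 * ((z.2 - ⟪w, z.1⟫) * ⟪z.1, u⟫) + ⟪z.1, u⟫ ^ 2) := by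
    intro z
    rw [inner_add_left, real_inner_comm z.1 u]
    ring
  have i1 := (hreg.integrable_residual_mul w u).const_mul (-2)
  have i2 := hreg.integrable_inner_sq u
  simp only [risk, hexp]
  erw [integral_add (hreg.integrable_residual_sq w) (i1.add i2), integral_add i1 i2]
  rw [integral_const_mul, hreg.inner_secondMoment_self]
  ring

lemma RegularityCondition.inner_secondMoment_nonneg (hreg : RegularityCondition 𝒟) (u : E) :
    0 ≤ ⟪u, secondMoment 𝒟 u⟫ := by
  rw [hreg.inner_secondMoment_self]
  exact integral_nonneg fun z => sq_nonneg _

/-- The first-order condition at the minimizer, read off from the exact quadratic expansion of the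
risk. -/
lemma RegularityCondition.integral_residual_eq_zero (hreg : RegularityCondition 𝒟)
    (hopt : ∀ w : E, risk 𝒟 wstar ≤ risk 𝒟 w) (u : E) :
    ∫ z, (z.2 - ⟪wstar, z.1⟫) * ⟪z.1, u⟫ ∂𝒟 = 0 := by
  set c := ∫ z, (z.2 - ⟪wstar, z.1⟫) * ⟪z.1, u⟫ ∂𝒟 with hc
  set q := ⟪u, secondMoment 𝒟 u⟫ with hq
  have hq0 : 0 ≤ q := hreg.inner_secondMoment_nonneg u
  -- The optimal step would be `c / q`; `q + 1` avoids dividing by zero and still forces `t² (q + 2)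
  -- ≤ 0` for `t = c / (q + 1)`.
  have h := hopt (wstar + (c / (q + 1)) • u)
  rw [hreg.risk_add] at h
  simp only [inner_smul_right, map_smul, inner_smul_left, mul_left_comm _ (c / (q + 1)),
    integral_const_mul, ← hc, ← hq, RCLike.conj_to_real] at h
  have h1 : 0 < q + 1 := by linarith
  set t := c / (q + 1) with ht
  have hct : c = t * (q + 1) := by rw [ht]; field_simp
  have h2 : t ^ 2 * (q + 2) ≤ 0 := by rw [hct] at h; nlinarith
  have h3 : t ^ 2 = 0 := by
    have := sq_nonneg t
    nlinarith
  rw [hct, pow_eq_zero_iff two_ne_zero |>.1 h3, zero_mul]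

lemma RegularityCondition.risk_eq (hreg : RegularityCondition 𝒟)
    (hopt : ∀ w : E, risk 𝒟 wstar ≤ risk 𝒟 w) (w : E) :
    risk 𝒟 w = risk 𝒟 wstar + (1 / 2) * ⟪w - wstar, secondMoment 𝒟 (w - wstar)⟫ := by
  have := hreg.risk_add wstar (w - wstar)
  rwa [hreg.integral_residual_eq_zero hopt, sub_zero, add_sub_cancel] at this

/-- With `Σ = R S R` and `R` symmetric, `⟪u, Σu⟫ = ⟪Ru, S(Ru)⟫ ≤ ‖S‖ ‖Ru‖²`, and `‖Ru‖² = ⟪u, Hu⟫`.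
No inverse of `R` is needed. -/
lemma isNoise_residual (hreg : RegularityCondition 𝒟)
    (hopt : ∀ w : E, risk 𝒟 wstar ≤ risk 𝒟 w) (hnoise : NoiseCondition 𝒟 wstar σ) :
    IsNoise 𝒟 (fun z => z.2 - ⟪wstar, z.1⟫) (σ ^ 2) where
  measurable := by fun_prop
  integrable_sq := by
    refine hnoise.1.norm.congr (Filter.Eventually.of_forall fun z => ?_)
    simp [norm_smul, norm_outer]
  centred := hreg.integral_residual_eq_zero hopt
  sq_le u := by
    obtain ⟨hint, R, S, hR, hRR, hRSR, hS⟩ := hnoise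
    have h1 : ∫ z, (z.2 - ⟪wstar, z.1⟫) ^ 2 * ⟪z.1, u⟫ ^ 2 ∂𝒟
        = ⟪u, gradientNoise 𝒟 wstar u⟫ := by
      unfold gradientNoise
      rw [ContinuousLinearMap.integral_apply hint,
        ← integral_inner (hint.apply_continuousLinearMap u)]
      refine integral_congr_ae (Filter.Eventually.of_forall fun z => ?_)
      simp only [smul_apply, outer_apply, inner_smul_right, real_inner_comm z.1 u]
      ring
    have hsym : ∀ x y, ⟪x, R y⟫ = ⟪R x, y⟫ := fun x y => (hR.1 x y).symm
    rw [h1, ← hRSR, ← hRR]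
    simp only [ContinuousLinearMap.comp_apply]
    rw [hsym, hsym u (R u), real_inner_self_eq_norm_sq, hS]
    calc ⟪R u, S (R u)⟫ ≤ ‖R u‖ * ‖S (R u)‖ := real_inner_le_norm _ _
      _ ≤ ‖R u‖ * (‖S‖ * ‖R u‖) := by gcongr; exact S.le_opNorm _
      _ = ‖S‖ * ‖R u‖ ^ 2 := by ring

end Residual

/-! ### Bias–variance splitting and the iterates as random variables -/

section Iterates

variable {E : Type*} [NormedAddCommGroup E] [InnerProductSpace ℝ E]
  {ξ : E × ℝ → ℝ} {γ : ℝ} {u₀ : E}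

/-- The SGD iterates in which the response of an example is replaced by a function `ξ` of it. -/
def noisyIterate (ξ : E × ℝ → ℝ) (γ : ℝ) (u₀ : E) (z : ℕ → E × ℝ) (t : ℕ) : E :=
  sgd γ u₀ (fun i => ((z i).1, ξ (z i))) t

lemma noisyIterate_succ (z : ℕ → E × ℝ) (t : ℕ) :
    noisyIterate ξ γ u₀ z (t + 1) =
      sgdStep γ (noisyIterate ξ γ u₀ z t) (z t).1 (ξ (z t)) := rfl

lemma noisyIterate_congr {z z' : ℕ → E × ℝ} {t : ℕ} (h : ∀ i < t, z i = z' i) :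
    noisyIterate ξ γ u₀ z t = noisyIterate ξ γ u₀ z' t := by
  induction t with
  | zero => rfl
  | succ t ih =>
    rw [noisyIterate_succ, noisyIterate_succ, ih fun i hi => h i (hi.trans t.lt_succ_self),
      h t t.lt_succ_self]

lemma biasIterate_eq_noisyIterate (z : ℕ → E × ℝ) (t : ℕ) :
    biasIterate γ u₀ z t = noisyIterate (fun _ => 0) γ u₀ z t := by
  induction t with
  | zero => rfl
  | succ t ih =>
    rw [noisyIterate_succ, ← ih, biasIterate, sgdStep, outer_apply,
      real_inner_comm (z t).1]
    module

lemma sgd_eq_add (wstar w₀ : E) (z : ℕ → E × ℝ) (t : ℕ) :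
    sgd γ w₀ z t = wstar + (noisyIterate (fun _ => 0) γ (w₀ - wstar) z t +
      noisyIterate (fun z => z.2 - ⟪wstar, z.1⟫) γ 0 z t) := by
  induction t with
  | zero => simp [sgd, noisyIterate]
  | succ t ih =>
    rw [noisyIterate_succ, noisyIterate_succ, sgd, ih]
    simp only [sgdStep, inner_add_left]
    module

variable [SecondCountableTopology E] [MeasurableSpace E] [BorelSpace E]

lemma measurable_noisyIterate (hξ : Measurable ξ) (t : ℕ) :
    Measurable fun z : ℕ → E × ℝ => noisyIterate ξ γ u₀ z t := by
  induction t with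
  | zero => exact measurable_const
  | succ t ih =>
    simp only [noisyIterate_succ, sgdStep]
    fun_prop

/-- The sequence `Z` consists of independent samples from `𝒟`. -/
structure IsSample {Ω : Type*} [MeasurableSpace Ω] (P : Measure Ω) (𝒟 : Measure (E × ℝ))
    (Z : ℕ → Ω → E × ℝ) : Prop where
  measurable : ∀ t, Measurable (Z t)
  law : ∀ t, P.map (Z t) = 𝒟
  indep : iIndepFun Z P

variable [CompleteSpace E] {𝒟 : Measure (E × ℝ)} [IsProbabilityMeasure 𝒟] {α s : ℝ}
  {Ω : Type*} [MeasurableSpace Ω] {P : Measure Ω} [IsProbabilityMeasure P]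
  {Z : ℕ → Ω → E × ℝ}

namespace IsSample

omit [CompleteSpace E] [IsProbabilityMeasure 𝒟] [IsProbabilityMeasure P] in
lemma measurable_iterate (hZ : IsSample P 𝒟 Z) (hξ : Measurable ξ) (t : ℕ) :
    Measurable fun ω => noisyIterate ξ γ u₀ (fun i => Z i ω) t :=
  (measurable_noisyIterate hξ t).comp (measurable_pi_lambda _ hZ.measurable)

omit [CompleteSpace E] [IsProbabilityMeasure 𝒟] [IsProbabilityMeasure P] in
lemma indepFun_iterate (hZ : IsSample P 𝒟 Z) (hξ : Measurable ξ) (t : ℕ) :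
    IndepFun (fun ω => noisyIterate ξ γ u₀ (fun i => Z i ω) t) (Z t) P :=
  indepFun_of_past hZ.measurable hZ.indep (measurable_noisyIterate hξ t)
    fun _ _ => noisyIterate_congr

omit [CompleteSpace E] in
lemma integrable_norm_iterate_sq (hZ : IsSample P 𝒟 Z) (hreg : RegularityCondition 𝒟)
    (hξ : IsNoise 𝒟 ξ s) (t : ℕ) :
    Integrable (fun ω => ‖noisyIterate ξ γ u₀ (fun i => Z i ω) t‖ ^ 2) P := by
  induction t with
  | zero => simp [noisyIterate, sgd]
  | succ t ih =>
    exact integrable_norm_sgdStep_sq (ξ := ξ) hreg hξ (hZ.measurable_iterate hξ.measurable t)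
      (hZ.measurable t) (hZ.law t) (hZ.indepFun_iterate hξ.measurable t) ih

/-- The iterates started at `0` are centred. -/
lemma integral_inner_iterate (hZ : IsSample P 𝒟 Z) (hreg : RegularityCondition 𝒟)
    (hξ : IsNoise 𝒟 ξ s) (t : ℕ) (u : E) :
    ∫ ω, ⟪u, noisyIterate ξ γ 0 (fun i => Z i ω) t⟫ ∂P = 0 := by
  induction t generalizing u with
  | zero => simp [noisyIterate, sgd]
  | succ t ih =>
    have := integral_mul_inner_sgdStep (γ := γ) hreg hξ (S := fun _ : Ω => (1 : ℝ))
      measurable_const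
      (hZ.measurable_iterate (γ := γ) (u₀ := 0) hξ.measurable t) (hZ.measurable t) (hZ.law t)
      ((hZ.indepFun_iterate hξ.measurable t).comp (φ := fun y => ((1 : ℝ), y))
        (by fun_prop) measurable_id) (by simp)
      (hZ.integrable_norm_iterate_sq hreg hξ t) u
    simpa [ih, noisyIterate_succ] using this

end IsSample

omit [IsProbabilityMeasure 𝒟] [IsProbabilityMeasure P] in
/-- Expansion of `𝔼 ⟪Y, H Y⟫` along the eigenvectors of `H`. -/
lemma hasSum_integral_quadratic (hreg : RegularityCondition 𝒟) {lam : ℕ → ℝ} {v : ℕ → E}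
    (heig : IsEigendecomposition (secondMoment 𝒟) lam v) {Y : Ω → E} (hY : Measurable Y)
    (hYint : Integrable (fun ω => ‖Y ω‖ ^ 2) P) :
    HasSum (fun i => lam i * ∫ ω, ⟪v i, Y ω⟫ ^ 2 ∂P)
      (∫ ω, ⟪Y ω, secondMoment 𝒟 (Y ω)⟫ ∂P) := by
  have hint : ∀ i, Integrable (fun ω => lam i * ⟪v i, Y ω⟫ ^ 2) P := fun i =>
    (integrable_inner_sq_of_norm_sq hY hYint (v i)).const_mul _
  have hnn : ∀ i ω, 0 ≤ lam i * ⟪v i, Y ω⟫ ^ 2 := fun i ω =>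
    mul_nonneg (heig.nonneg i) (sq_nonneg _)
  have hle : ∀ i ω, lam i * ⟪v i, Y ω⟫ ^ 2 ≤ lam i * ‖Y ω‖ ^ 2 := by
    intro i ω
    by_cases hi : lam i = 0
    · simp [hi]
    · refine mul_le_mul_of_nonneg_left ?_ (heig.nonneg i)
      have := pow_le_pow_left₀ (abs_nonneg _) (abs_real_inner_le_norm (v i) (Y ω)) 2
      rwa [sq_abs, heig.norm_eq_one hi, one_mul] at this
  have hs : Summable fun i => ∫ ω, ‖lam i * ⟪v i, Y ω⟫ ^ 2‖ ∂P := by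
    refine Summable.of_nonneg_of_le (fun i => integral_nonneg fun ω => norm_nonneg _)
      (fun i => ?_) ((hreg.summable_eigenvalues heig).mul_right (∫ ω, ‖Y ω‖ ^ 2 ∂P))
    rw [← integral_const_mul]
    refine integral_mono (hint i).norm (hYint.const_mul _) fun ω => ?_
    simpa only [Real.norm_of_nonneg (hnn i ω)] using hle i ω
  have := hasSum_integral_of_summable_integral_norm hint hs
  simpa only [(heig.hasSum_quadratic _).tsum_eq, integral_const_mul] using this

end Iterates

/-! ### Variance and bias of the averaged iterate -/

section Variance

variable {E : Type*} [NormedAddCommGroup E] [InnerProductSpace ℝ E] [CompleteSpace E]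
  [SecondCountableTopology E] [MeasurableSpace E] [BorelSpace E]
  {𝒟 : Measure (E × ℝ)} [IsProbabilityMeasure 𝒟] {α s γ : ℝ} {ξ : E × ℝ → ℝ}
  {Ω : Type*} [MeasurableSpace Ω] {P : Measure Ω} [IsProbabilityMeasure P]
  {Z : ℕ → Ω → E × ℝ} {lam : ℕ → ℝ} {v : ℕ → E}

/-- The second moments of the centred iterates along the eigenvectors of `H`. -/
lemma IsSample.integral_inner_iterate_sq_le (hZ : IsSample P 𝒟 Z)
    (hreg : RegularityCondition 𝒟) (hfourth : FourthMomentCondition 𝒟 α) (hα : 0 ≤ α)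
    (hξ : IsNoise 𝒟 ξ s) (hs : 0 ≤ s)
    (heig : IsEigendecomposition (secondMoment 𝒟) lam v) (hγ : 0 ≤ γ)
    (hγtr : 2 * γ * (α * ∑' i, lam i) = 1) (hγlam : ∀ i, γ * lam i ≤ 1) (t i : ℕ)
    (hi : lam i ≠ 0) :
    ∫ ω, ⟪v i, noisyIterate ξ γ 0 (fun j => Z j ω) t⟫ ^ 2 ∂P ≤
      2 * γ * s * (1 - (1 - γ * lam i) ^ t) := by
  induction t generalizing i with
  | zero => simp [noisyIterate, sgd]
  | succ t ih =>
    have hYm := hZ.measurable_iterate (γ := γ) (u₀ := 0) hξ.measurable t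
    have hYint := hZ.integrable_norm_iterate_sq (γ := γ) (u₀ := 0) hreg hξ t
    have hsum := hasSum_integral_quadratic hreg heig hYm hYint
    have hlam := hreg.summable_eigenvalues heig
    have hq : ∀ j, 0 ≤ 1 - γ * lam j := fun j => by linarith [hγlam j]
    -- The recursion couples all directions through `𝔼⟪Y, HY⟫`, so the induction hypothesis is used
    -- for every eigenvector, weakened to `2γs`.
    have hQ : ∫ ω, ⟪noisyIterate ξ γ 0 (fun j => Z j ω) t,
        secondMoment 𝒟 (noisyIterate ξ γ 0 (fun j => Z j ω) t)⟫ ∂P ≤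
        (∑' j, lam j) * (2 * γ * s) := by
      refine hasSum_le (fun j => ?_) hsum (hlam.hasSum.mul_right _)
      by_cases hj : lam j = 0
      · simp [hj]
      · refine mul_le_mul_of_nonneg_left ((ih j hj).trans ?_) (heig.nonneg j)
        have := pow_nonneg (hq j) t
        exact mul_le_of_le_one_right (by positivity) (by linarith)
    have hstep := integral_inner_sgdStep_sq_le (γ := γ) hreg hfourth hξ hYm (hZ.measurable t)
      (hZ.law t) (hZ.indepFun_iterate hξ.measurable t) hYint
      (hZ.integral_inner_iterate hreg hξ t) (heig.norm_eq_one hi) (heig.apply_eq hi)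
    simp only [noisyIterate_succ]
    set c := ∫ ω, ⟪v i, noisyIterate ξ γ 0 (fun j => Z j ω) t⟫ ^ 2 ∂P with hc
    have hc0 : 0 ≤ c := integral_nonneg fun ω => sq_nonneg _
    have hl := heig.nonneg i
    have h1 : α * ∫ ω, ⟪noisyIterate ξ γ 0 (fun j => Z j ω) t,
        secondMoment 𝒟 (noisyIterate ξ γ 0 (fun j => Z j ω) t)⟫ ∂P ≤ s := by
      calc _ ≤ α * ((∑' j, lam j) * (2 * γ * s)) := mul_le_mul_of_nonneg_left hQ hα
        _ = (2 * γ * (α * ∑' j, lam j)) * s := by ring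
        _ = s := by rw [hγtr, one_mul]
    have h2 : γ ^ 2 * lam i * (α * (∫ ω, ⟪noisyIterate ξ γ 0 (fun j => Z j ω) t,
        secondMoment 𝒟 (noisyIterate ξ γ 0 (fun j => Z j ω) t)⟫ ∂P) + s) ≤
        γ ^ 2 * lam i * (s + s) := by gcongr
    have h3 : (1 - γ * lam i) * c ≤
        (1 - γ * lam i) * (2 * γ * s * (1 - (1 - γ * lam i) ^ t)) :=
      mul_le_mul_of_nonneg_left (ih i hi) (hq i)
    -- Half of the contraction `1 - 2γλ` is discarded; the remaining recursion `c ↦ (1 - γλ) c +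
    -- 2γ²λs` has fixed point `2γs`.
    have h4 : 0 ≤ γ * lam i * c := by positivity
    rw [pow_succ]
    linarith

omit [CompleteSpace E] in
lemma measurable_sum_inner_noisyIterate (hξ : Measurable ξ) (w : E) (t : ℕ) :
    Measurable fun z : ℕ → E × ℝ =>
      ∑ j ∈ Finset.range t, ⟪w, noisyIterate ξ γ 0 z j⟫ :=
  Finset.measurable_fun_sum _ fun j _ =>
    measurable_const.inner (measurable_noisyIterate hξ j)

omit [CompleteSpace E] in
lemma IsSample.integrable_sum_inner_sq (hZ : IsSample P 𝒟 Z)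
    (hreg : RegularityCondition 𝒟) (hξ : IsNoise 𝒟 ξ s) (w : E) (t : ℕ) :
    Integrable (fun ω =>
      (∑ j ∈ Finset.range t, ⟪w, noisyIterate ξ γ 0 (fun k => Z k ω) j⟫) ^ 2) P := by
  refine MemLp.integrable_sq (memLp_finsetSum _ fun j _ => ?_)
  have hm := hZ.measurable_iterate (γ := γ) (u₀ := 0) hξ.measurable j
  exact (memLp_two_iff_integrable_sq (Measurable.aestronglyMeasurable (by fun_prop))).2
    (integrable_inner_sq_of_norm_sq hm (hZ.integrable_norm_iterate_sq hreg hξ j) w)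

/-- The second moment of the sum of the centred iterates along an eigenvector of `H`. -/
lemma IsSample.integral_sum_inner_sq_le (hZ : IsSample P 𝒟 Z)
    (hreg : RegularityCondition 𝒟) (hξ : IsNoise 𝒟 ξ s) {w : E} {l m : ℝ} {N : ℕ}
    (hw : secondMoment 𝒟 w = l • w) (hl : 0 ≤ γ * l) (hl1 : γ * l ≤ 1) (hm : 0 ≤ m)
    (hle : ∀ t < N, ∫ ω, ⟪w, noisyIterate ξ γ 0 (fun j => Z j ω) t⟫ ^ 2 ∂P ≤ m) :
    γ * l * ∫ ω, (∑ j ∈ Finset.range N, ⟪w, noisyIterate ξ γ 0 (fun k => Z k ω) j⟫) ^ 2 ∂P ≤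
      N * (2 * m * (1 - (1 - γ * l) ^ N)) := by
  set q := 1 - γ * l with hq
  have hq0 : 0 ≤ q := by linarith
  have hq1 : q ≤ 1 := by linarith
  let S : ℕ → Ω → ℝ := fun t ω =>
    ∑ j ∈ Finset.range t, ⟪w, noisyIterate ξ γ 0 (fun k => Z k ω) j⟫
  let Y : ℕ → Ω → E := fun t ω => noisyIterate ξ γ 0 (fun k => Z k ω) t
  have hS : ∀ t, Measurable (S t) := fun t =>
    (measurable_sum_inner_noisyIterate hξ.measurable w t).comp
      (measurable_pi_lambda _ hZ.measurable)
  have hY : ∀ t, Measurable (Y t) := fun t => hZ.measurable_iterate hξ.measurable t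
  have hSint : ∀ t, Integrable (fun ω => S t ω ^ 2) P := fun t =>
    hZ.integrable_sum_inner_sq hreg hξ w t
  have hYint : ∀ t, Integrable (fun ω => ‖Y t ω‖ ^ 2) P := fun t =>
    hZ.integrable_norm_iterate_sq hreg hξ t
  have hcint : ∀ t, Integrable (fun ω => ⟪w, Y t ω⟫ ^ 2) P := fun t =>
    integrable_inner_sq_of_norm_sq (hY t) (hYint t) w
  have hDint : ∀ t, Integrable (fun ω => S t ω * ⟪w, Y t ω⟫) P := fun t =>
    integrable_mul_inner (hS t) (hY t) (hSint t) (hYint t) w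
  have hSsucc : ∀ t ω, S (t + 1) ω = S t ω + ⟪w, Y t ω⟫ := fun t ω => Finset.sum_range_succ _ _
  -- `S (t + 1)` sums the iterates `0, …, t`, and iterate `t` uses only the samples before `Z t`.
  have hind : ∀ t, IndepFun (fun ω => (S (t + 1) ω, Y t ω)) (Z t) P := fun t => by
    refine indepFun_of_past hZ.measurable hZ.indep
      (g := fun z => (∑ j ∈ Finset.range (t + 1), ⟪w, noisyIterate ξ γ 0 z j⟫,
        noisyIterate ξ γ 0 z t)) ?_ fun z z' h => ?_
    · exact (measurable_sum_inner_noisyIterate hξ.measurable w _).prodMk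
        (measurable_noisyIterate hξ.measurable t)
    · refine congrArg₂ Prod.mk (Finset.sum_congr rfl fun j hj => ?_) (noisyIterate_congr h)
      have := Finset.mem_range.1 hj
      rw [noisyIterate_congr fun i hi => h i (by omega)]
  have hD : ∀ t, ∫ ω, S (t + 1) ω * ⟪w, Y (t + 1) ω⟫ ∂P =
      q * (∫ ω, S t ω * ⟪w, Y t ω⟫ ∂P + ∫ ω, ⟪w, Y t ω⟫ ^ 2 ∂P) := by
    intro t
    have h := integral_mul_inner_sgdStep (γ := γ) hreg hξ (hS (t + 1)) (hY t) (hZ.measurable t)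
      (hZ.law t) (hind t) (hSint (t + 1)) (hYint t) w
    have h2 : ∫ ω, S (t + 1) ω * ⟪w, Y t ω⟫ ∂P =
        ∫ ω, S t ω * ⟪w, Y t ω⟫ ∂P + ∫ ω, ⟪w, Y t ω⟫ ^ 2 ∂P := by
      rw [← integral_add (hDint t) (hcint t)]
      refine integral_congr_ae (Filter.Eventually.of_forall fun ω => ?_)
      simp only [hSsucc]
      ring
    rw [hw] at h
    simp only [inner_smul_left, RCLike.conj_to_real, mul_left_comm _ l, integral_const_mul,
      h2] at h
    change ∫ ω, S (t + 1) ω * ⟪w, sgdStep γ (Y t ω) (Z t ω).1 (ξ (Z t ω))⟫ ∂P = _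
    rw [h, hq]
    ring
  -- With the second moments bounded by `m`, `hD` is dominated by `D ↦ q (D + m)` started at `0`,
  -- solved by `m q (1 - q^t) / (1 - q)`. The factor `γ * l = 1 - q` stays on the left so that `l =
  -- 0` is allowed.
  have hDle : ∀ t ≤ N, γ * l * ∫ ω, S t ω * ⟪w, Y t ω⟫ ∂P ≤ m * q * (1 - q ^ t) := by
    intro t
    induction t with
    | zero => simp [S]
    | succ t ih =>
      intro ht
      have h1 := mul_le_mul_of_nonneg_left (ih (by omega)) hq0
      have h2 := mul_le_mul_of_nonneg_left (hle t (by omega)) (mul_nonneg hq0 hl)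
      rw [hD, pow_succ]
      have h3 : γ * l = 1 - q := by rw [hq]; ring
      calc _ = q * (γ * l * ∫ ω, S t ω * ⟪w, Y t ω⟫ ∂P) +
            q * (γ * l) * ∫ ω, ⟪w, Y t ω⟫ ^ 2 ∂P := by ring
        _ ≤ q * (m * q * (1 - q ^ t)) + q * (γ * l) * m := add_le_add h1 h2
        _ = _ := by rw [h3]; ring
  -- After scaling by `1 - q`, each increment is at most `2mq(1 - q^t) + m(1 - q) ≤ 2m(1 - q^(t+1))
  -- ≤ 2m(1 - q^N)`.
  have hmain : ∀ t ≤ N, γ * l * ∫ ω, S t ω ^ 2 ∂P ≤ t * (2 * m * (1 - q ^ N)) := by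
    intro t
    induction t with
    | zero => simp [S]
    | succ t ih =>
      intro ht
      have h1 : ∫ ω, S (t + 1) ω ^ 2 ∂P = ∫ ω, S t ω ^ 2 ∂P +
          (2 * ∫ ω, S t ω * ⟪w, Y t ω⟫ ∂P + ∫ ω, ⟪w, Y t ω⟫ ^ 2 ∂P) := by
        rw [← integral_const_mul, ← integral_add ((hDint t).const_mul 2) (hcint t),
          ← integral_add (g := fun ω => 2 * (S t ω * ⟪w, Y t ω⟫) + ⟪w, Y t ω⟫ ^ 2) (hSint t)
            (((hDint t).const_mul 2).add (hcint t))]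
        refine integral_congr_ae (Filter.Eventually.of_forall fun ω => ?_)
        simp only [hSsucc]
        ring
      have h2 := ih (by omega)
      have h3 := hDle t (by omega)
      have h4 := mul_le_mul_of_nonneg_left (hle t (by omega)) hl
      have h5 : q ^ N ≤ q ^ (t + 1) := pow_le_pow_of_le_one hq0 hq1 ht
      have h6 : m * q ^ N ≤ m * q ^ (t + 1) := mul_le_mul_of_nonneg_left h5 hm
      have h7 : γ * l * m = m - m * q := by rw [hq]; ring
      have h8 : m * q ≤ m := mul_le_of_le_one_right hm hq1
      rw [h7] at h4
      rw [h1, mul_add, mul_add]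
      push_cast
      have h9 : m * q * (1 - q ^ t) = m * q - m * q ^ (t + 1) := by ring
      rw [h9] at h3
      linarith
  exact hmain N le_rfl

omit [CompleteSpace E] [SecondCountableTopology E] [MeasurableSpace E] [BorelSpace E] in
lemma inner_average (w : E) (N : ℕ) (u : ℕ → E) :
    ⟪w, average N u⟫ = (N : ℝ)⁻¹ * ∑ t ∈ Finset.range N, ⟪w, u t⟫ := by
  rw [average, inner_smul_right, inner_sum]

omit [CompleteSpace E] [SecondCountableTopology E] [MeasurableSpace E] [BorelSpace E] in
lemma norm_average_sq_le (N : ℕ) (u : ℕ → E) :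
    ‖average N u‖ ^ 2 ≤ (N : ℝ)⁻¹ * ∑ t ∈ Finset.range N, ‖u t‖ ^ 2 := by
  have h1 : ‖∑ t ∈ Finset.range N, u t‖ ^ 2 ≤ N * ∑ t ∈ Finset.range N, ‖u t‖ ^ 2 := by
    refine (pow_le_pow_left₀ (norm_nonneg _) (norm_sum_le _ _) 2).trans ?_
    simpa using sq_sum_le_card_mul_sum_sq (s := Finset.range N) (f := fun t => ‖u t‖)
  rw [average, norm_smul, mul_pow, Real.norm_of_nonneg (by positivity)]
  rcases N.eq_zero_or_pos with rfl | hN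
  · simp
  · calc (N : ℝ)⁻¹ ^ 2 * ‖∑ t ∈ Finset.range N, u t‖ ^ 2
        ≤ (N : ℝ)⁻¹ ^ 2 * (N * ∑ t ∈ Finset.range N, ‖u t‖ ^ 2) := by gcongr
      _ = _ := by field_simp

omit [CompleteSpace E] [IsProbabilityMeasure 𝒟] [IsProbabilityMeasure P] in
lemma IsSample.measurable_average (hZ : IsSample P 𝒟 Z) (hξ : Measurable ξ) (u₀ : E) (N : ℕ) :
    Measurable fun ω => average N (noisyIterate ξ γ u₀ fun j => Z j ω) :=
  (Finset.measurable_fun_sum _ fun t _ => hZ.measurable_iterate hξ t).const_smul _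

omit [CompleteSpace E] in
lemma IsSample.integrable_norm_average_sq (hZ : IsSample P 𝒟 Z)
    (hreg : RegularityCondition 𝒟) (hξ : IsNoise 𝒟 ξ s) (u₀ : E) (N : ℕ) :
    Integrable (fun ω => ‖average N (noisyIterate ξ γ u₀ fun j => Z j ω)‖ ^ 2) P := by
  have hm := hZ.measurable_average (γ := γ) hξ.measurable u₀ N
  refine ((integrable_finsetSum (Finset.range N) fun t _ =>
    hZ.integrable_norm_iterate_sq (γ := γ) (u₀ := u₀) hreg hξ t).const_mul (N : ℝ)⁻¹).mono'
    (Measurable.aestronglyMeasurable (by fun_prop)) (Filter.Eventually.of_forall fun ω => ?_)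
  rw [Real.norm_of_nonneg (by positivity)]
  exact norm_average_sq_le _ _

/-- The variance error, for an arbitrary split of the spectrum into head and tail. -/
lemma IsSample.variance_le (hZ : IsSample P 𝒟 Z)
    (hreg : RegularityCondition 𝒟) (hfourth : FourthMomentCondition 𝒟 α) (hα : 0 ≤ α)
    (hξ : IsNoise 𝒟 ξ s) (hs : 0 ≤ s)
    (heig : IsEigendecomposition (secondMoment 𝒟) lam v) (hγ : 0 < γ)
    (hγtr : 2 * γ * (α * ∑' i, lam i) = 1) (hγlam : ∀ i, γ * lam i ≤ 1)
    {N : ℕ} (hN : 1 ≤ N) (k : ℕ) :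
    ∫ ω, ⟪average N (noisyIterate ξ γ 0 fun j => Z j ω),
        secondMoment 𝒟 (average N (noisyIterate ξ γ 0 fun j => Z j ω))⟫ ∂P ≤
      4 * s * ((k : ℝ) / N + N * γ ^ 2 * ∑' i, lam (k + i) ^ 2) := by
  have hNpos : (0 : ℝ) < N := by exact_mod_cast hN
  have hsum := hasSum_integral_quadratic hreg heig
    (hZ.measurable_average (γ := γ) hξ.measurable 0 N)
    (hZ.integrable_norm_average_sq hreg hξ 0 N)
  set f : ℕ → ℝ := fun i =>
    lam i * ∫ ω, ⟪v i, average N (noisyIterate ξ γ 0 fun j => Z j ω)⟫ ^ 2 ∂P with hf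
  have hlam := hreg.summable_eigenvalues heig
  -- One factor `1 - (1 - γλ)^N` comes from the size of the iterates, the other from their
  -- correlations. Both are needed for the square of `λ` in the tail.
  have hkey : ∀ i, f i ≤ 4 * s / N * (1 - (1 - γ * lam i) ^ N) ^ 2 := by
    intro i
    by_cases hi : lam i = 0
    · simp [hf, hi]
    have hl := heig.nonneg i
    have hq0 : 0 ≤ 1 - γ * lam i := by linarith [hγlam i]
    have hq1 : 1 - γ * lam i ≤ 1 := by linarith [mul_nonneg hγ.le hl]
    have h := hZ.integral_sum_inner_sq_le (γ := γ) (N := N) hreg hξ (heig.apply_eq hi)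
      (mul_nonneg hγ.le hl) (hγlam i) (m := 2 * γ * s * (1 - (1 - γ * lam i) ^ N))
      (mul_nonneg (by positivity) (sub_nonneg.2 (pow_le_one₀ hq0 hq1))) (fun t ht => by
        refine (hZ.integral_inner_iterate_sq_le hreg hfourth hα hξ hs heig hγ.le hγtr hγlam t i
          hi).trans ?_
        gcongr 2 * γ * s * (1 - ?_)
        exact pow_le_pow_of_le_one hq0 hq1 ht.le)
    have hfi : f i = (N : ℝ)⁻¹ ^ 2 * γ⁻¹ * (γ * lam i * ∫ ω, (∑ j ∈ Finset.range N,
        ⟪v i, noisyIterate ξ γ 0 (fun k => Z k ω) j⟫) ^ 2 ∂P) := by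
      simp only [hf, inner_average, mul_pow, integral_const_mul]
      field_simp
    rw [hfi]
    calc _ ≤ (N : ℝ)⁻¹ ^ 2 * γ⁻¹ * (N * (2 * (2 * γ * s * (1 - (1 - γ * lam i) ^ N)) *
          (1 - (1 - γ * lam i) ^ N))) := by gcongr
      _ = _ := by field_simp; ring
  have hhead : ∀ i, f i ≤ 4 * s / N := by
    intro i
    refine (hkey i).trans (mul_le_of_le_one_right (by positivity) ?_)
    have hq0 : 0 ≤ 1 - γ * lam i := by linarith [hγlam i]
    have hq1 : 1 - γ * lam i ≤ 1 := by linarith [mul_nonneg hγ.le (heig.nonneg i)]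
    exact pow_le_one₀ (sub_nonneg.2 (pow_le_one₀ hq0 hq1)) (by linarith [pow_nonneg hq0 N])
  have htail : ∀ i, f i ≤ 4 * s / N * (N * γ) ^ 2 * lam i ^ 2 := by
    intro i
    refine (hkey i).trans ?_
    have hl := mul_nonneg hγ.le (heig.nonneg i)
    have hq0 : 0 ≤ 1 - γ * lam i := by linarith [hγlam i]
    -- Bernoulli: `1 - (1 - γλ)^N ≤ Nγλ`.
    have hb := one_add_mul_le_pow (a := -(γ * lam i)) (by linarith [hγlam i]) N
    rw [mul_assoc, ← mul_pow]
    gcongr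
    · exact sub_nonneg.2 (pow_le_one₀ hq0 (by linarith))
    · rw [← sub_eq_add_neg] at hb
      linarith
  have hlam2 : Summable fun i => lam i ^ 2 := by
    refine Summable.of_nonneg_of_le (fun i => sq_nonneg _) (fun i => ?_) (hlam.mul_left (lam 0))
    rw [sq]
    exact mul_le_mul_of_nonneg_right (heig.antitone (Nat.zero_le i)) (heig.nonneg i)
  rw [← hsum.tsum_eq, ← hsum.summable.sum_add_tsum_nat_add k]
  have h1 : ∑ i ∈ Finset.range k, f i ≤ k * (4 * s / N) := by
    simpa using Finset.sum_le_card_nsmul (Finset.range k) f _ fun i _ => hhead i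
  have h2 : ∑' i, f (i + k) ≤ 4 * s / N * (N * γ) ^ 2 * ∑' i, lam (k + i) ^ 2 := by
    rw [← tsum_mul_left]
    have hs2 : Summable fun i => lam (k + i) ^ 2 := by
      simpa only [add_comm k] using (summable_nat_add_iff k).2 hlam2
    refine ((summable_nat_add_iff k).2 hsum.summable).tsum_le_tsum (fun i => ?_)
      (hs2.mul_left _)
    rw [add_comm k i]
    exact htail _
  refine (add_le_add h1 h2).trans (le_of_eq ?_)
  field_simp

/-- The bias error. -/
lemma IsSample.bias_le (hZ : IsSample P 𝒟 Z)
    (hreg : RegularityCondition 𝒟) (hfourth : FourthMomentCondition 𝒟 α)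
    (hγ : 0 < γ) (hγtr : 2 * γ * (α * trace (secondMoment 𝒟)) = 1) (β₀ : E) (N : ℕ) :
    ∫ ω, ⟪average N (noisyIterate (fun _ => 0) γ β₀ fun j => Z j ω),
        secondMoment 𝒟 (average N (noisyIterate (fun _ => 0) γ β₀ fun j => Z j ω))⟫ ∂P ≤
      2 / (3 * γ) * ‖β₀‖ ^ 2 / N := by
  let Y : ℕ → Ω → E := fun t ω => noisyIterate (fun _ => 0) γ β₀ (fun k => Z k ω) t
  let Q : ℕ → ℝ := fun t => ∫ ω, ⟪Y t ω, secondMoment 𝒟 (Y t ω)⟫ ∂P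
  have hξ := isNoise_zero (𝒟 := 𝒟)
  have hY : ∀ t, Measurable (Y t) := fun t => hZ.measurable_iterate hξ.measurable t
  have hYint : ∀ t, Integrable (fun ω => ‖Y t ω‖ ^ 2) P := fun t =>
    hZ.integrable_norm_iterate_sq hreg hξ t
  have hstep : ∀ t, ∫ ω, ‖Y (t + 1) ω‖ ^ 2 ∂P ≤
      ∫ ω, ‖Y t ω‖ ^ 2 ∂P - 3 / 2 * γ * Q t := by
    intro t
    have h := integral_norm_sgdStep_zero_sq_le (γ := γ) hreg hfourth (hY t) (hZ.measurable t)
      (hZ.law t) (hZ.indepFun_iterate hξ.measurable t) (hYint t)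
    -- Since `γ α tr H = 1/2`, the second-order term takes back only a quarter of the first-order
    -- decrease.
    have h2 : 2 * γ - γ ^ 2 * (α * trace (secondMoment 𝒟)) = 3 / 2 * γ := by
      linear_combination (-(γ / 2)) * hγtr
    rw [h2] at h
    exact h
  have htel : ∀ t, 3 / 2 * γ * ∑ j ∈ Finset.range t, Q j + ∫ ω, ‖Y t ω‖ ^ 2 ∂P ≤ ‖β₀‖ ^ 2 := by
    intro t
    induction t with
    | zero => simp [Y, noisyIterate, sgd]
    | succ t ih =>
      rw [Finset.sum_range_succ, mul_add]
      linarith [hstep t]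
  have hsumQ : ∑ j ∈ Finset.range N, Q j ≤ 2 / (3 * γ) * ‖β₀‖ ^ 2 := by
    have h1 : 0 ≤ ∫ ω, ‖Y N ω‖ ^ 2 ∂P := integral_nonneg fun ω => sq_nonneg _
    have h2 : 3 / 2 * γ * ∑ j ∈ Finset.range N, Q j ≤ ‖β₀‖ ^ 2 := by linarith [htel N]
    calc _ = 2 / (3 * γ) * (3 / 2 * γ * ∑ j ∈ Finset.range N, Q j) := by field_simp
      _ ≤ _ := by gcongr
  have hconv : ∀ u : ℕ → E, ⟪average N u, secondMoment 𝒟 (average N u)⟫ ≤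
      (N : ℝ)⁻¹ * ∑ t ∈ Finset.range N, ⟪u t, secondMoment 𝒟 (u t)⟫ := by
    intro u
    simp only [hreg.inner_secondMoment_self]
    rw [← integral_finsetSum _ fun t _ => hreg.integrable_inner_sq (u t), ← integral_const_mul]
    refine integral_mono (hreg.integrable_inner_sq _)
      ((integrable_finsetSum _ fun t _ => hreg.integrable_inner_sq (u t)).const_mul _)
      fun z => ?_
    -- As `⟪u, Hu⟫ = 𝔼⟪x, u⟫²`, convexity of the energy reduces to that of the square on real
    -- numbers.
    have := norm_average_sq_le N fun t => ⟪z.1, u t⟫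
    simp only [Real.norm_eq_abs, sq_abs] at this
    rw [inner_average]
    simpa [average] using this
  have hQint : ∀ t, Integrable (fun ω => ⟪Y t ω, secondMoment 𝒟 (Y t ω)⟫) P := fun t =>
    integrable_quadratic (hY t) (hYint t)
  calc _ ≤ ∫ ω, (N : ℝ)⁻¹ * ∑ t ∈ Finset.range N, ⟪Y t ω, secondMoment 𝒟 (Y t ω)⟫ ∂P := by
        refine integral_mono (integrable_quadratic
          (hZ.measurable_average hξ.measurable β₀ N)
          (hZ.integrable_norm_average_sq hreg hξ β₀ N))
          ((integrable_finsetSum _ fun t _ => hQint t).const_mul _) fun ω => hconv _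
    _ = (N : ℝ)⁻¹ * ∑ t ∈ Finset.range N, Q t := by
        rw [integral_const_mul, integral_finsetSum _ fun t _ => hQint t]
    _ ≤ (N : ℝ)⁻¹ * (2 / (3 * γ) * ‖β₀‖ ^ 2) := by gcongr
    _ = _ := by ring

omit [IsProbabilityMeasure 𝒟] in
lemma RegularityCondition.quadratic_add_le (hreg : RegularityCondition 𝒟) (a b : E) :
    ⟪a + b, secondMoment 𝒟 (a + b)⟫ ≤
      2 * ⟪a, secondMoment 𝒟 a⟫ + 2 * ⟪b, secondMoment 𝒟 b⟫ := by
  have h := hreg.inner_secondMoment_nonneg (a - b)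
  simp only [map_sub, map_add, inner_add_left, inner_add_right, inner_sub_left,
    inner_sub_right] at h ⊢
  linarith

omit [CompleteSpace E] [SecondCountableTopology E] [MeasurableSpace E] [BorelSpace E] in
lemma average_const_add {N : ℕ} (hN : 1 ≤ N) (w : E) (a b : ℕ → E) :
    average N (fun t => w + (a t + b t)) = w + (average N a + average N b) := by
  have : (N : ℝ) ≠ 0 := by positivity
  simp only [average, Finset.sum_add_distrib, smul_add, Finset.sum_const, Finset.card_range]
  rw [← Nat.cast_smul_eq_nsmul ℝ, smul_smul, inv_mul_cancel₀ this, one_smul]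

end Variance

lemma IsEigendecomposition.tsum_pos {E : Type*} [NormedAddCommGroup E] [InnerProductSpace ℝ E]
    {T : E →L[ℝ] E} {lam : ℕ → ℝ} {v : ℕ → E} (h : IsEigendecomposition T lam v)
    (hs : Summable lam) {u : E} (hu : ⟪u, T u⟫ ≠ 0) : 0 < ∑' i, lam i := by
  refine lt_of_le_of_ne (tsum_nonneg h.nonneg) fun h0 => hu ?_
  have hz : ∀ i, lam i = 0 := fun i =>
    le_antisymm (h0 ▸ hs.le_tsum i fun j _ => h.nonneg j) (h.nonneg i)
  simpa [hz] using (h.hasSum_quadratic u).tsum_eq.symm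

end SGDRegression

/-! ### Assembly of the two bounds -/

theorem corollary2p2
    {E : Type*} [NormedAddCommGroup E] [InnerProductSpace ℝ E] [CompleteSpace E]
    [TopologicalSpace.SeparableSpace E] [Nontrivial E] [MeasurableSpace E] [BorelSpace E]
    (𝒟 : Measure (E × ℝ)) [IsProbabilityMeasure 𝒟]
    (wstar : E) (α σ : ℝ)
    (hreg : SGDRegression.RegularityCondition 𝒟)
    (hopt : ∀ w : E, SGDRegression.risk 𝒟 wstar ≤ SGDRegression.risk 𝒟 w)
    (hα : 0 < α)
    (hfourth : SGDRegression.FourthMomentCondition 𝒟 α)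
    (hnoise : SGDRegression.NoiseCondition 𝒟 wstar σ)
    (lam : ℕ → ℝ) (v : ℕ → E)
    (heig : SGDRegression.IsEigendecomposition (SGDRegression.secondMoment 𝒟) lam v)
    {Ω : Type*} [MeasurableSpace Ω] (P : Measure Ω) [IsProbabilityMeasure P]
    (Z : ℕ → Ω → E × ℝ)
    (hmeas : ∀ t, Measurable (Z t))
    (hlaw : ∀ t, P.map (Z t) = 𝒟)
    (hindep : iIndepFun Z P)
    (w₀ : E) (N : ℕ) (hN : 1 ≤ N)
    (γ : ℝ) (hγ : γ = 1 / (2 * α * ∑' i, lam i))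
    (k : ℕ) (hk : k = SGDRegression.effectiveDim lam (2 * α * (∑' i, lam i) / N)) :
    -- the excess risk bound
    (Integrable (fun ω => SGDRegression.risk 𝒟
        (SGDRegression.average N (SGDRegression.sgd γ w₀ (fun t => Z t ω)))) P ∧
      (∫ ω, SGDRegression.risk 𝒟
          (SGDRegression.average N (SGDRegression.sgd γ w₀ (fun t => Z t ω))) ∂P)
        - SGDRegression.risk 𝒟 wstar
      ≤ 8 * α * ‖w₀ - wstar‖ ^ 2 * (∑' i, lam i) / N
        + 4 * σ ^ 2 * ((k : ℝ) / N
            + N * (∑' i, lam (k + i) ^ 2) / (4 * α ^ 2 * (∑' i, lam i) ^ 2))) ∧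
    -- the bias error is `O(1/N)`, with the constant of the first term above
    (Integrable (fun ω => (1 / 2 : ℝ) *
        ⟪SGDRegression.average N (SGDRegression.biasIterate γ (w₀ - wstar) (fun t => Z t ω)),
          SGDRegression.secondMoment 𝒟
            (SGDRegression.average N
              (SGDRegression.biasIterate γ (w₀ - wstar) (fun t => Z t ω)))⟫) P ∧
      (∫ ω, (1 / 2 : ℝ) *
        ⟪SGDRegression.average N (SGDRegression.biasIterate γ (w₀ - wstar) (fun t => Z t ω)),
          SGDRegression.secondMoment 𝒟
            (SGDRegression.average N
              (SGDRegression.biasIterate γ (w₀ - wstar) (fun t => Z t ω)))⟫ ∂P)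
      ≤ 8 * α * ‖w₀ - wstar‖ ^ 2 * (∑' i, lam i) / N) := by
  have : SecondCountableTopology E := UniformSpace.secondCountable_of_separable E
  have hZ : SGDRegression.IsSample P 𝒟 Z := ⟨hmeas, hlaw, hindep⟩
  have hlam := hreg.summable_eigenvalues heig
  obtain ⟨u, hu⟩ := exists_ne (0 : E)
  have hT := heig.tsum_pos hlam (hreg.posDef u hu).ne'
  have htrace := heig.trace_eq hlam
  have hα1 := hfourth.one_le hreg
  have hle : ∀ i, lam i ≤ ∑' i, lam i := fun i => hlam.le_tsum i fun j _ => heig.nonneg j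
  set T := ∑' i, lam i with hTdef
  have hNpos : (0 : ℝ) < N := by exact_mod_cast hN
  have hγpos : 0 < γ := by rw [hγ]; positivity
  have hγT : 2 * γ * (α * T) = 1 := by rw [hγ]; field_simp
  have hγlam : ∀ i, γ * lam i ≤ 1 := fun i => by
    have h1 : γ * lam i ≤ γ * (α * T) := by
      gcongr
      exact (hle i).trans (le_mul_of_one_le_left hT.le hα1)
    linarith
  have hz := SGDRegression.isNoise_zero (𝒟 := 𝒟)
  have hξ := SGDRegression.isNoise_residual hreg hopt hnoise
  have ibias := SGDRegression.integrable_quadratic (𝒟 := 𝒟)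
    (hZ.measurable_average (γ := γ) hz.measurable (w₀ - wstar) N)
    (hZ.integrable_norm_average_sq hreg hz (w₀ - wstar) N)
  have ivar := SGDRegression.integrable_quadratic (𝒟 := 𝒟)
    (hZ.measurable_average (γ := γ) hξ.measurable 0 N)
    (hZ.integrable_norm_average_sq hreg hξ 0 N)
  have hbias := hZ.bias_le hreg hfourth hγpos (by rw [htrace]; exact hγT) (w₀ - wstar) N
  have hvar := hZ.variance_le hreg hfourth hα.le hξ (sq_nonneg σ) heig hγpos hγT hγlam hN k
  -- Here `2 / (3γ) = (4/3) α T`, so the constant `8` leaves room to spare.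
  have hb : 2 / (3 * γ) * ‖w₀ - wstar‖ ^ 2 / N ≤ 8 * α * ‖w₀ - wstar‖ ^ 2 * T / N := by
    have : 2 / (3 * γ) ≤ 8 * (α * T) := by
      rw [div_le_iff₀ (by positivity)]
      linarith
    calc _ ≤ 8 * (α * T) * ‖w₀ - wstar‖ ^ 2 / N := by gcongr
      _ = _ := by ring
  have hb0 : 0 ≤ 8 * α * ‖w₀ - wstar‖ ^ 2 * T / N := by positivity
  have hv : N * γ ^ 2 * ∑' i, lam (k + i) ^ 2 =
      N * (∑' i, lam (k + i) ^ 2) / (4 * α ^ 2 * T ^ 2) := by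
    rw [hγ]; field_simp; ring
  rw [hv] at hvar
  have hiter : ∀ ω, SGDRegression.average N (SGDRegression.sgd γ w₀ fun t => Z t ω) - wstar =
      SGDRegression.average N
        (SGDRegression.noisyIterate (fun _ => 0) γ (w₀ - wstar) fun t => Z t ω) +
      SGDRegression.average N
        (SGDRegression.noisyIterate (fun z => z.2 - ⟪wstar, z.1⟫) γ 0 fun t => Z t ω) := by
    intro ω
    rw [funext (SGDRegression.sgd_eq_add wstar w₀ fun t => Z t ω),
      SGDRegression.average_const_add hN, add_sub_cancel_left]
  have hsgd : Measurable fun ω => SGDRegression.average N (SGDRegression.noisyIterate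
      (fun _ => 0) γ (w₀ - wstar) fun t => Z t ω) + SGDRegression.average N
        (SGDRegression.noisyIterate (fun z => z.2 - ⟪wstar, z.1⟫) γ 0 fun t => Z t ω) :=
    (hZ.measurable_average hz.measurable _ N).add (hZ.measurable_average hξ.measurable 0 N)
  simp only [hreg.risk_eq hopt (SGDRegression.average N _), hiter,
    fun ω => funext (SGDRegression.biasIterate_eq_noisyIterate (γ := γ) (u₀ := w₀ - wstar)
      fun t => Z t ω)]
  -- The factor `2` from splitting the quadratic form cancels the `1/2` in the risk. The same
  -- domination gives integrability.
  have hdom := (ibias.const_mul 2).add (ivar.const_mul 2)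
  have itot := hdom.mono' (g := fun ω => _) (f := fun ω => ⟪_, SGDRegression.secondMoment 𝒟 _⟫)
    (Measurable.aestronglyMeasurable (hsgd.inner
      ((SGDRegression.secondMoment 𝒟).continuous.measurable.comp hsgd)))
    (Filter.Eventually.of_forall fun ω => by
      rw [Real.norm_of_nonneg (hreg.inner_secondMoment_nonneg _)]
      exact hreg.quadratic_add_le _ _)
  have htot := integral_mono itot hdom fun ω => hreg.quadratic_add_le _ _
  erw [integral_add (ibias.const_mul 2) (ivar.const_mul 2)] at htot
  rw [integral_const_mul, integral_const_mul] at htot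
  refine ⟨⟨(integrable_const _).add (itot.const_mul _), ?_⟩, ibias.const_mul _, ?_⟩
  · rw [integral_add (integrable_const _) (itot.const_mul _), integral_const_mul]
    simp only [integral_const, probReal_univ, one_smul]
    simp only at htot ⊢
    linarith
  · rw [integral_const_mul]
    linarith
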